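/- Let $M\ge 0$ and consider the Gaussian wiretap channel with $M$ helpers, $$Y_1=\sum_{i=1}^{M+1}h_iX_i+N_1,\qquad Y_2=\sum_{i=1}^{M+1}g_iX_i+N_2,$$ with nonzero real gains $h_i,g_i$, where $Y_1$ is observed by the legitimate receiver, $Y_2$ by the eavesdropper, and $N_1,N_2$ are independent $\mathcal N(0,1)$ noises, i.i.d. in time. Bold letters denote sequences over $n\ge 1$ channel uses. A code of length $n$ consists of a message $W$, uniform on a finite set $\mathcal W$, of rate $R=\frac1n\log|\mathcal W|$, channel inputs $\mathbf X_1,\dots,\mathbf X_{M+1}$, where $\mathbf X_1$ is produced from $W$ by a (possibly stochastic) encoder and $\mathbf X_2,\dots,\mathbf X_{M+1}$ are the (random) inputs of the helpers, and a decoder. The objects $(W,\mathbf X_1),\mathbf X_2,\dots,\mathbf X_{M+1},\mathbf N_1,\mathbf N_2$ are mutually independent. The code satisfies the power constraint $P$ if $\frac1n\sum_{t=1}^n E[X_{i,t}^2]\le P$ for every $i$; it is $\epsilon$-reliable if $W$ is decoded from $\mathbf Y_1$ with error probability at most $\epsilon$, and $\epsilon$-secure if $\frac1n I(W;\mathbf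 Y_2)\le\epsilon$. Let $\tilde{\mathbf X}_i=\mathbf X_i+\tilde{\mathbf N}_i$, where $\tilde{\mathbf N}_i$ is an i.i.d. sequence of $\mathcal N(0,\tilde\sigma_i^2)$ variables with $0<\tilde\sigma_i^2<\min(1/h_i^2,1/g_i^2)$, and $\tilde{\mathbf N}_1,\dots,\tilde{\mathbf N}_{M+1}$ are independent of each other and of all the other variables. Let $h(\cdot)$ denote differential entropy. Then there are constants $c,c'$, depending only on $M$, the gains $h_i,g_i$ and the variances $\tilde\sigma_i^2$ (and in particular not on $P$, $n$ or the code), such that for every $P\ge 0$ there is an $\epsilon>0$ with the following property. For every $n\ge1$ and every code of length $n$ that satisfies the power constraint $P$ and is $\epsilon$-reliable and $\epsilon$-secure, the differential entropies $h(\tilde{\mathbf X}_i)$ and $h(\mathbf Y_2)$ exist and are finite, and for every $j\in\{1,\dots,M+1\}$ $$nR\le\sum_{i=1}^{M+1}h(\tilde{\mathbf X}_i)-h(\mathbf Y_2)+nc\le\sum_{i=1,\,i\ne j}^{M+1}h(\tilde{\mathbf X}_i)+nc'.$$ -/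

import Mathlib

open MeasureTheory ProbabilityTheory
open scoped NNReal ENNReal

noncomputable section

namespace Wiretap

/-- The differential entropy `h = -∫ f log f` (in nats) of a law on `ℝⁿ` with Lebesgue density `f`.
It is meaningful for laws satisfying `HasDiffEntropy`. -/
def diffEntropy {n : ℕ} (ν : Measure (Fin n → ℝ)) : ℝ :=
  ∫ x, Real.negMulLog (ν.rnDeriv volume x).toReal ∂volume

/-- The law has a Lebesgue density `f`, and the integral of `f log f` converges absolutely: the
differential entropy exists and is finite. -/
def HasDiffEntropy {n : ℕ} (ν : Measure (Fin n → ℝ)) : Prop :=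
  ν ≪ volume ∧ Integrable (fun x => Real.negMulLog (ν.rnDeriv volume x).toReal) volume

/-- The mutual information `I(A; B)` (in nats): the Kullback-Leibler divergence of the joint law
from the product of the marginal laws. -/
def mutualInfo {Ω α β : Type*} [MeasurableSpace Ω] [MeasurableSpace α] [MeasurableSpace β]
    (μ : Measure Ω) (A : Ω → α) (B : Ω → β) : ℝ≥0∞ :=
  InformationTheory.klDiv (μ.map (fun ω => (A ω, B ω))) ((μ.map A).prod (μ.map B))

/-- The law of an i.i.d. sequence of `n` centred Gaussian variables of variance `v`. -/
def gaussianSeq (n : ℕ) (v : ℝ≥0) : Measure (Fin n → ℝ) :=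
  Measure.pi (fun _ => gaussianReal 0 v)

/-- The random variables of `n` uses of the Gaussian wiretap channel with `M` helpers, for a code
with `m` messages. Transmitter `0` is the legitimate one, transmitters `1, …, M` are the helpers.
The code itself consists of the joint law of `(W, X 0)` (a uniform message and a stochastic
encoder) and of the laws of the helper inputs `X 1, …, X M`. The variables `Nt i` are the
fudge noises, of variance `v i`. -/
structure Scheme (M n m : ℕ) (v : Fin (M + 1) → ℝ≥0) {Ω : Type*} [MeasurableSpace Ω]
    (μ : Measure Ω) where
  /-- the message -/
  W : Ω → Fin m
  /-- the `n`-letter channel inputs -/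
  X : Fin (M + 1) → Ω → Fin n → ℝ
  /-- the noise at the legitimate receiver -/
  N₁ : Ω → Fin n → ℝ
  /-- the noise at the eavesdropper -/
  N₂ : Ω → Fin n → ℝ
  /-- the fudge noises -/
  Nt : Fin (M + 1) → Ω → Fin n → ℝ
  measurable_W : Measurable W
  measurable_X : ∀ i, Measurable (X i)
  measurable_N₁ : Measurable N₁
  measurable_N₂ : Measurable N₂
  measurable_Nt : ∀ i, Measurable (Nt i)
  uniform_W : ∀ w, μ.real (W ⁻¹' {w}) = 1 / (m : ℝ)
  law_N₁ : μ.map N₁ = gaussianSeq n 1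
  law_N₂ : μ.map N₂ = gaussianSeq n 1
  law_Nt : ∀ i, μ.map (Nt i) = gaussianSeq n (v i)
  /-- The `2 M + 4` objects `(W, X 0), X 1, …, X M, N₁, N₂, Nt 0, …, Nt M` are mutually
  independent. -/
  indep : iIndep
    (Sum.elim
      (fun i : Fin (M + 1) =>
        if i = 0 then MeasurableSpace.comap (fun ω => (W ω, X 0 ω)) inferInstance
        else MeasurableSpace.comap (X i) inferInstance)
      (Sum.elim
        ![MeasurableSpace.comap N₁ inferInstance, MeasurableSpace.comap N₂ inferInstance]
        (fun i : Fin (M + 1) => MeasurableSpace.comap (Nt i) inferInstance))) μ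

namespace Scheme

variable {M n m : ℕ} {v : Fin (M + 1) → ℝ≥0} {Ω : Type*} [MeasurableSpace Ω] {μ : Measure Ω}

/-- The output at the legitimate receiver, `Y₁ = ∑ i, h i • X i + N₁`. -/
def Y₁ (S : Scheme M n m v μ) (h : Fin (M + 1) → ℝ) (ω : Ω) : Fin n → ℝ :=
  (∑ i, h i • S.X i ω) + S.N₁ ω

/-- The output at the eavesdropper, `Y₂ = ∑ i, g i • X i + N₂`. -/
def Y₂ (S : Scheme M n m v μ) (g : Fin (M + 1) → ℝ) (ω : Ω) : Fin n → ℝ :=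
  (∑ i, g i • S.X i ω) + S.N₂ ω

/-- The perturbed channel inputs. -/
def Xt (S : Scheme M n m v μ) (i : Fin (M + 1)) (ω : Ω) : Fin n → ℝ :=
  S.X i ω + S.Nt i ω

/-- The rate `R = (1/n) log m` (in nats per channel use). -/
def rate (_S : Scheme M n m v μ) : ℝ := 1 / (n : ℝ) * Real.log m

/-- Every transmitter satisfies the average power constraint
`(1/n) ∑ t, E[(X i t)²] ≤ P`. -/
def PowerConstraint (S : Scheme M n m v μ) (P : ℝ) : Prop :=
  ∀ i, (∀ t, Integrable (fun ω => S.X i ω t ^ 2) μ) ∧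
    1 / (n : ℝ) * ∑ t, ∫ ω, S.X i ω t ^ 2 ∂μ ≤ P

/-- The legitimate receiver can decode the message with error probability at most `ε`. -/
def Reliable (S : Scheme M n m v μ) (h : Fin (M + 1) → ℝ) (ε : ℝ) : Prop :=
  ∃ dec : (Fin n → ℝ) → Fin m, Measurable dec ∧ μ.real {ω | dec (S.Y₁ h ω) ≠ S.W ω} ≤ ε

/-- Weak secrecy at level `ε`: `I(W; Y₂) ≤ n ε`. -/
def Secure (S : Scheme M n m v μ) (g : Fin (M + 1) → ℝ) (ε : ℝ) : Prop :=
  mutualInfo μ S.W (S.Y₂ g) ≤ ENNReal.ofReal (n * ε)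

end Scheme

end Wiretap

end

/-! Both inequalities rest on Gibbs' inequality: `E[log r] ≤ 0` when `r > 0` and `E[r] ≤ 1`.

For the first one (`secrecy_penalty`), `r` compares the true joint law of message, inputs, outputs
and perturbed inputs with a fictitious one. There the `Xt i` are independent with their true
densities and pass through both channels with fresh unit noise; the message is guessed from `Y₁` by
a randomised version of the decoder; the inputs are drawn from their true conditional law given the
message and `Y₂`. The last choice cancels the kernel of `Y₂` and leaves the joint density of `(W,
Y₂)`, whose logarithm contributes `I(W; Y₂)` and `h(Y₂)`. The guess contributes `(1 - Pe) log m -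
log 2`, as in Fano's inequality. The remaining Gaussian factors are evaluated at the noises and at
the residuals `Y - ∑ i, a i • Xt i`, which do not involve the inputs, so they cost a multiple of `n`
independent of the power. No conditional differential entropy is needed.

For the second one, `g j ^ 2 * v j ≤ 1` lets `N₂` be split in law so that `Y₂` is distributed as `g
j • Xt j` plus an independent variable. Such an addition does not lower the entropy
(`diffEntropy_le_conv`, again by Gibbs), and scaling adds `n log |g j|`.

The term `Pe log m` is absorbed by the choice of `ε`: the power constraint first gives `log m ≤ 2 n
D` with `D` depending on `P`, and `ε = 1 / (2 D)` then makes the term at most `n`.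

All entropies are finite because every law involved is a Gaussian smoothing with finite second
moments (`IsRegularLaw`). -/

namespace Wiretap

/-! ### Gibbs' inequality and product Gaussian densities. -/

/-- Gibbs' inequality, in the form `E[r] ≤ 1 → E[log r] ≤ 0`. -/
lemma integral_log_nonpos {α : Type*} [MeasurableSpace α] {μ : Measure α} [IsProbabilityMeasure μ]
    {r : α → ℝ} (hr : ∀ a, 0 < r a) (hlog : Integrable (fun a => Real.log (r a)) μ)
    (hle : ∫⁻ a, ENNReal.ofReal (r a) ∂μ ≤ 1) : ∫ a, Real.log (r a) ∂μ ≤ 0 := by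
  -- Since `log r + 1 ≤ r`, the shift by one bounds the positive part of the integrand by `r`
  -- itself.
  have hint : Integrable (fun a => Real.log (r a) + 1) μ := hlog.add (integrable_const 1)
  have h1 : ∫ a, (Real.log (r a) + 1) ∂μ ≤ 1 := by
    rw [integral_eq_lintegral_pos_part_sub_lintegral_neg_part hint]
    have h2 : (∫⁻ a, ENNReal.ofReal (Real.log (r a) + 1) ∂μ).toReal ≤ 1 := by
      refine ENNReal.toReal_le_of_le_ofReal zero_le_one ?_
      rw [ENNReal.ofReal_one]
      refine le_trans (lintegral_mono fun a => ENNReal.ofReal_le_ofReal ?_) hle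
      linarith [Real.log_le_sub_one_of_pos (hr a)]
    linarith [ENNReal.toReal_nonneg (a := ∫⁻ a, ENNReal.ofReal (-(Real.log (r a) + 1)) ∂μ)]
  rw [integral_add hlog (integrable_const 1)] at h1
  simp only [integral_const, probReal_univ, smul_eq_mul, mul_one] at h1
  linarith

/-- A finite product of measures with densities has the product density. -/
lemma pi_withDensity {ι : Type*} [Fintype ι] {E : ι → Type*} [∀ i, MeasurableSpace (E i)]
    {μ : ∀ i, Measure (E i)} [∀ i, SigmaFinite (μ i)] {f : ∀ i, E i → ℝ}
    (hf : ∀ i, Integrable (f i) (μ i)) (hf0 : ∀ i x, 0 ≤ f i x) :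
    Measure.pi (fun i => (μ i).withDensity fun x => ENNReal.ofReal (f i x)) =
      (Measure.pi μ).withDensity fun x => ENNReal.ofReal (∏ i, f i (x i)) := by
  have : ∀ i, IsFiniteMeasure ((μ i).withDensity fun x => ENNReal.ofReal (f i x)) := fun i =>
    isFiniteMeasure_withDensity_ofReal (hf i).2
  refine Measure.pi_eq fun s hs => ?_
  rw [withDensity_apply _ (MeasurableSet.univ_pi hs), Measure.restrict_pi_pi,
    ← ofReal_integral_eq_lintegral_ofReal, integral_fintype_prod_eq_prod,
    ENNReal.ofReal_prod_of_nonneg]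
  · refine Finset.prod_congr rfl fun i _ => ?_
    rw [withDensity_apply _ (hs i), ofReal_integral_eq_lintegral_ofReal (hf i).restrict]
    exact ae_of_all _ (hf0 i)
  · exact fun i _ => integral_nonneg (hf0 i)
  · exact Integrable.fintype_prod_dep (μ := fun i => (μ i).restrict (s i)) fun i => (hf i).restrict
  · exact ae_of_all _ fun x => Finset.prod_nonneg fun i _ => hf0 i _

variable {n : ℕ}

/-- The density of `gaussianSeq n v`. -/
noncomputable def gaussianDensity (v : ℝ≥0) (x : Fin n → ℝ) : ℝ := ∏ t, gaussianPDFReal 0 v (x t)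

lemma gaussianDensity_pos {v : ℝ≥0} (hv : v ≠ 0) (x : Fin n → ℝ) : 0 < gaussianDensity v x :=
  Finset.prod_pos fun _ _ => gaussianPDFReal_pos _ _ _ hv

@[fun_prop]
lemma measurable_gaussianDensity (v : ℝ≥0) : Measurable (gaussianDensity (n := n) v) :=
  Finset.measurable_prod _ fun t _ => (measurable_gaussianPDFReal 0 v).comp (measurable_pi_apply t)

lemma gaussianDensity_le (v : ℝ≥0) (x : Fin n → ℝ) :
    gaussianDensity v x ≤ (√(2 * Real.pi * v))⁻¹ ^ n := by
  calc gaussianDensity v x ≤ ∏ _t : Fin n, (√(2 * Real.pi * v))⁻¹ := by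
        refine Finset.prod_le_prod (fun t _ => gaussianPDFReal_nonneg _ _ _) fun t _ => ?_
        rw [gaussianPDFReal]
        refine mul_le_of_le_one_right (by positivity) (Real.exp_le_one_iff.2 ?_)
        exact div_nonpos_of_nonpos_of_nonneg (by simp [sq_nonneg]) (by positivity)
    _ = _ := by simp

lemma log_gaussianDensity {v : ℝ≥0} (hv : v ≠ 0) (x : Fin n → ℝ) :
    Real.log (gaussianDensity v x) =
      -(n * (Real.log (2 * Real.pi * v) / 2)) - (∑ t, x t ^ 2) / (2 * v) := by
  have hv' : (0 : ℝ) < v := by positivity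
  rw [gaussianDensity, Real.log_prod fun t _ => (gaussianPDFReal_pos _ _ _ hv).ne']
  have : ∀ t, Real.log (gaussianPDFReal 0 v (x t)) =
      -(Real.log (2 * Real.pi * v) / 2) - x t ^ 2 / (2 * v) := fun t => by
    rw [gaussianPDFReal, Real.log_mul (by positivity) (by positivity), Real.log_exp, Real.log_inv,
      Real.log_sqrt (by positivity)]
    ring
  simp only [this, Finset.sum_sub_distrib, Finset.sum_const, Finset.card_univ, Fintype.card_fin,
    nsmul_eq_mul, ← Finset.sum_div]
  ring

lemma integrable_gaussianDensity (v : ℝ≥0) : Integrable (gaussianDensity (n := n) v) :=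
  Integrable.fintype_prod fun _ => integrable_gaussianPDFReal 0 v

lemma gaussianSeq_eq_withDensity {v : ℝ≥0} (hv : v ≠ 0) :
    gaussianSeq n v = volume.withDensity fun x => ENNReal.ofReal (gaussianDensity v x) := by
  rw [gaussianSeq, gaussianReal_of_var_ne_zero _ hv]
  exact pi_withDensity (fun _ => integrable_gaussianPDFReal 0 v)
    fun _ => gaussianPDFReal_nonneg 0 v

instance (v : ℝ≥0) : IsProbabilityMeasure (gaussianSeq n v) := by
  unfold gaussianSeq; infer_instance

lemma lintegral_gaussianDensity {v : ℝ≥0} (hv : v ≠ 0) :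
    ∫⁻ x : Fin n → ℝ, ENNReal.ofReal (gaussianDensity v x) = 1 := by
  rw [← setLIntegral_univ, ← withDensity_apply _ MeasurableSet.univ,
    ← gaussianSeq_eq_withDensity hv, measure_univ]

/-! ### Regular laws and their differential entropy. -/

/-- The probability measure `ν` has the positive bounded density `f` and finite second moments. -/
structure IsRegularLaw (ν : Measure (Fin n → ℝ)) (f : (Fin n → ℝ) → ℝ) : Prop where
  prob : IsProbabilityMeasure ν
  measurable : Measurable f
  pos : ∀ x, 0 < f x
  bdd : ∃ C, ∀ x, f x ≤ C
  eq_withDensity : ν = volume.withDensity fun x => ENNReal.ofReal (f x)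
  sq : ∀ t, Integrable (fun x => x t ^ 2) ν

namespace IsRegularLaw

variable {ν : Measure (Fin n → ℝ)} {f : (Fin n → ℝ) → ℝ}

lemma integrable_sum_sq (H : IsRegularLaw ν f) : Integrable (fun x => ∑ t, x t ^ 2) ν :=
  integrable_finsetSum _ fun t _ => H.sq t

/-- This is how the condition `E[r] ≤ 1` of Gibbs' inequality is checked when `r` has the true
density as denominator. -/
lemma lintegral_div (H : IsRegularLaw ν f) {k : (Fin n → ℝ) → ℝ} (hk : Measurable k) :
    ∫⁻ x, ENNReal.ofReal (k x / f x) ∂ν = ∫⁻ x, ENNReal.ofReal (k x) := by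
  have hf := H.measurable
  rw [H.eq_withDensity, lintegral_withDensity_eq_lintegral_mul _ (by fun_prop) (by fun_prop)]
  refine lintegral_congr fun x => ?_
  rw [Pi.mul_apply, ← ENNReal.ofReal_mul (H.pos x).le, mul_div_cancel₀ _ (H.pos x).ne']

lemma lintegral_density (H : IsRegularLaw ν f) : ∫⁻ x, ENNReal.ofReal (f x) = 1 := by
  have := H.prob
  rw [← setLIntegral_univ, ← withDensity_apply _ MeasurableSet.univ,
    ← H.eq_withDensity, measure_univ]

lemma integrable_density (H : IsRegularLaw ν f) : Integrable f := by
  refine ⟨H.measurable.aestronglyMeasurable, ?_⟩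
  rw [hasFiniteIntegral_iff_ofReal (ae_of_all _ fun x => (H.pos x).le), H.lintegral_density]
  exact ENNReal.one_lt_top

lemma integrable_log_gaussianDensity (H : IsRegularLaw ν f) :
    Integrable (fun x => Real.log (gaussianDensity 1 x)) ν := by
  have := H.prob
  simp_rw [log_gaussianDensity one_ne_zero]
  exact (integrable_const _).sub (H.integrable_sum_sq.div_const _)

/-- The bound on `f` controls `log f` from above. From below, `log f ≥ log γ - γ / f` with `γ` the
standard Gaussian density: `log γ` is integrable by the second moments, and `γ / f` has integral one
under `ν`. -/
lemma integrable_log (H : IsRegularLaw ν f) : Integrable (fun x => Real.log (f x)) ν := by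
  have := H.prob
  have hf := H.measurable
  obtain ⟨C, hC⟩ := H.bdd
  have hr : Integrable (fun x => gaussianDensity 1 x / f x) ν := by
    refine ⟨Measurable.aestronglyMeasurable (by fun_prop), ?_⟩
    rw [hasFiniteIntegral_iff_ofReal
      (ae_of_all _ fun x => (div_pos (gaussianDensity_pos one_ne_zero x) (H.pos x)).le),
      H.lintegral_div (by fun_prop), lintegral_gaussianDensity one_ne_zero]
    exact ENNReal.one_lt_top
  refine integrable_of_le_of_le (g₁ := fun x => Real.log (gaussianDensity 1 x) -
    gaussianDensity 1 x / f x) (g₂ := fun _ => Real.log C)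
    (Measurable.aestronglyMeasurable (by fun_prop)) (ae_of_all _ fun x => ?_)
    (ae_of_all _ fun x => Real.log_le_log (H.pos x) (hC x))
    (H.integrable_log_gaussianDensity.sub hr) (integrable_const _)
  have h1 := Real.log_le_sub_one_of_pos (div_pos (gaussianDensity_pos one_ne_zero x) (H.pos x))
  rw [Real.log_div (gaussianDensity_pos one_ne_zero x).ne' (H.pos x).ne'] at h1
  dsimp only
  linarith

lemma rnDeriv_ae_eq (H : IsRegularLaw ν f) :
    (fun x => Real.negMulLog (ν.rnDeriv volume x).toReal) =ᵐ[volume]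
      fun x => -(f x * Real.log (f x)) := by
  have h1 : ν.rnDeriv volume =ᵐ[volume] fun x => ENNReal.ofReal (f x) := by
    rw [H.eq_withDensity]
    exact Measure.rnDeriv_withDensity _ H.measurable.ennreal_ofReal
  filter_upwards [h1] with x hx
  rw [hx, ENNReal.toReal_ofReal (H.pos x).le, Real.negMulLog, neg_mul]

lemma hasDiffEntropy (H : IsRegularLaw ν f) : HasDiffEntropy ν := by
  refine ⟨?_, ?_⟩
  · rw [H.eq_withDensity]
    exact withDensity_absolutelyContinuous _ _
  · rw [integrable_congr H.rnDeriv_ae_eq]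
    have h1 := H.integrable_log
    rw [H.eq_withDensity, integrable_withDensity_iff H.measurable.ennreal_ofReal
      (ae_of_all _ fun x => ENNReal.ofReal_lt_top)] at h1
    refine h1.neg.congr (ae_of_all _ fun x => ?_)
    simp only [Pi.neg_apply, ENNReal.toReal_ofReal (H.pos x).le]
    ring

lemma diffEntropy_eq (H : IsRegularLaw ν f) :
    diffEntropy ν = -∫ x, Real.log (f x) ∂ν := by
  rw [diffEntropy, integral_congr_ae H.rnDeriv_ae_eq, integral_neg]
  congr 1
  rw [H.eq_withDensity, integral_withDensity_eq_integral_toReal_smul H.measurable.ennreal_ofReal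
      (ae_of_all _ fun x => ENNReal.ofReal_lt_top)]
  refine integral_congr_ae (ae_of_all _ fun x => ?_)
  simp only [ENNReal.toReal_ofReal (H.pos x).le, smul_eq_mul]

/-- A second moment bound on the differential entropy. -/
lemma diffEntropy_le (H : IsRegularLaw ν f) :
    diffEntropy ν ≤ n * (Real.log (2 * Real.pi) / 2) + (∑ t, ∫ x, x t ^ 2 ∂ν) / 2 := by
  have := H.prob
  have hg := fun x => gaussianDensity_pos (n := n) one_ne_zero x
  have hlog : ∀ x, Real.log (gaussianDensity 1 x / f x) =
      Real.log (gaussianDensity 1 x) - Real.log (f x) := fun x =>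
    Real.log_div (hg x).ne' (H.pos x).ne'
  have h1 := integral_log_nonpos (μ := ν) (r := fun x => gaussianDensity 1 x / f x)
    (fun x => div_pos (hg x) (H.pos x))
    (by simp_rw [hlog]; exact H.integrable_log_gaussianDensity.sub H.integrable_log)
    (by rw [H.lintegral_div (by fun_prop), lintegral_gaussianDensity one_ne_zero])
  simp_rw [hlog] at h1
  rw [integral_sub H.integrable_log_gaussianDensity H.integrable_log] at h1
  have h2 : ∫ x, Real.log (gaussianDensity 1 x) ∂ν =
      -(n * (Real.log (2 * Real.pi) / 2) + (∑ t, ∫ x, x t ^ 2 ∂ν) / 2) := by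
    simp_rw [log_gaussianDensity (n := n) one_ne_zero]
    rw [integral_sub (integrable_const _) (H.integrable_sum_sq.div_const _), integral_div,
      integral_finsetSum _ fun t _ => H.sq t]
    simp
    ring
  rw [H.diffEntropy_eq]
  linarith

/-- Scaling a law by `c` adds `n log |c|` to its differential entropy. -/
lemma smul (H : IsRegularLaw ν f) {c : ℝ} (hc : c ≠ 0) :
    IsRegularLaw (ν.map fun x => c • x) (fun x => (|c| ^ n)⁻¹ * f (c⁻¹ • x)) := by
  have := H.prob
  have hf := H.measurable
  obtain ⟨C, hC⟩ := H.bdd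
  have hc' : 0 < (|c| ^ n)⁻¹ := by positivity
  have hm : Measurable fun x : Fin n → ℝ => c • x := by fun_prop
  refine ⟨Measure.isProbabilityMeasure_map hm.aemeasurable, by fun_prop,
    fun x => mul_pos hc' (H.pos _), ⟨_, fun x => mul_le_mul_of_nonneg_left (hC _) hc'.le⟩, ?_,
    fun t => ?_⟩
  · refine Measure.ext_of_lintegral _ fun F hF => ?_
    rw [lintegral_map hF hm, lintegral_withDensity_eq_lintegral_mul _ (by fun_prop) hF,
      H.eq_withDensity, lintegral_withDensity_eq_lintegral_mul _ (by fun_prop) (by fun_prop)]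
    simp only [Pi.mul_apply]
    -- Scaling multiplies Lebesgue measure by the constant `(|c| ^ n)⁻¹`, which appears on both
    -- sides and is cancelled at the end.
    have h1 := Measure.map_addHaar_smul (volume : Measure (Fin n → ℝ)) hc
    have h2 := lintegral_map (μ := (volume : Measure (Fin n → ℝ)))
      (f := fun x => ENNReal.ofReal ((|c| ^ n)⁻¹ * f (c⁻¹ • x)) * F x) (by fun_prop) hm
    rw [h1, lintegral_smul_measure] at h2
    simp only [inv_smul_smul₀ hc, Module.finrank_fin_fun, abs_inv, abs_pow, smul_eq_mul] at h2
    have h3 : ∀ x, ENNReal.ofReal ((|c| ^ n)⁻¹ * f x) * F (c • x) =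
        ENNReal.ofReal (|c| ^ n)⁻¹ * (ENNReal.ofReal (f x) * F (c • x)) := fun x => by
      rw [ENNReal.ofReal_mul hc'.le, mul_assoc]
    simp_rw [h3] at h2
    rw [lintegral_const_mul _ (by fun_prop)] at h2
    exact (((ENNReal.mul_right_inj (by simpa using hc') ENNReal.ofReal_ne_top).1 h2)).symm
  · rw [integrable_map_measure (Measurable.aestronglyMeasurable (by fun_prop)) hm.aemeasurable]
    refine ((H.sq t).const_mul (c ^ 2)).congr (ae_of_all _ fun x => ?_)
    simp [mul_pow]

lemma diffEntropy_smul (H : IsRegularLaw ν f) {c : ℝ} (hc : c ≠ 0) :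
    diffEntropy (ν.map fun x => c • x) = diffEntropy ν + n * Real.log |c| := by
  have := H.prob
  have hf := H.measurable
  rw [(H.smul hc).diffEntropy_eq, integral_map (by fun_prop)
    (Measurable.aestronglyMeasurable (by fun_prop)), H.diffEntropy_eq]
  simp only [inv_smul_smul₀ hc]
  have : ∀ x, Real.log ((|c| ^ n)⁻¹ * f x) = -(n * Real.log |c|) + Real.log (f x) := fun x => by
    rw [Real.log_mul (by positivity) (H.pos x).ne', Real.log_inv, Real.log_pow]
  simp_rw [this]
  rw [integral_add (integrable_const _) H.integrable_log]
  simp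

/-- Adding an independent variable does not decrease the differential entropy. -/
lemma diffEntropy_le_conv (H : IsRegularLaw ν f) {ρ : Measure (Fin n → ℝ)}
    [IsProbabilityMeasure ρ] {p : (Fin n → ℝ) → ℝ} (Hp : IsRegularLaw (ν.conv ρ) p) :
    diffEntropy ν ≤ diffEntropy (ν.conv ρ) := by
  have := H.prob
  have hf := H.measurable
  have hp := Hp.measurable
  have i1 : Integrable (fun z : (Fin n → ℝ) × (Fin n → ℝ) => Real.log (p (z.1 + z.2)))
      (ν.prod ρ) := by
    have := Hp.integrable_log
    rw [Measure.conv, integrable_map_measure (Measurable.aestronglyMeasurable (by fun_prop))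
      (by fun_prop)] at this
    exact this
  have i2 : Integrable (fun z : (Fin n → ℝ) × (Fin n → ℝ) => Real.log (f z.1)) (ν.prod ρ) :=
    H.integrable_log.comp_fst ρ
  have hlog : ∀ z : (Fin n → ℝ) × (Fin n → ℝ), Real.log (p (z.1 + z.2) / f z.1) =
      Real.log (p (z.1 + z.2)) - Real.log (f z.1) := fun z =>
    Real.log_div (Hp.pos _).ne' (H.pos _).ne'
  have h1 := integral_log_nonpos (μ := ν.prod ρ)
    (r := fun z : (Fin n → ℝ) × (Fin n → ℝ) => p (z.1 + z.2) / f z.1)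
    (fun z => div_pos (Hp.pos _) (H.pos _)) (by simp_rw [hlog]; exact i1.sub i2) (by
      -- For a fixed value `s` of the added variable, integrating over `x` cancels `f`, and
      -- translation invariance leaves the total mass of `p`.
      rw [lintegral_prod_symm _ (by fun_prop)]
      have : ∀ s, ∫⁻ x, ENNReal.ofReal (p (x + s) / f x) ∂ν = 1 := fun s => by
        rw [H.lintegral_div (k := fun x => p (x + s)) (by fun_prop),
          lintegral_add_right_eq_self (fun x => ENNReal.ofReal (p x)) s, Hp.lintegral_density]
      simp [this])
  simp_rw [hlog] at h1
  rw [integral_sub i1 i2, integral_fun_fst (f := fun x => Real.log (f x))] at h1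
  rw [H.diffEntropy_eq, Hp.diffEntropy_eq, Measure.conv, integral_map (by fun_prop)
    (Measurable.aestronglyMeasurable (by fun_prop))]
  simp at h1
  linarith

end IsRegularLaw

/-! ### Gaussian sequences under sums, scaling and evaluation. -/

lemma gaussianSeq_conv (a b : ℝ≥0) :
    (gaussianSeq n a).conv (gaussianSeq n b) = gaussianSeq n (a + b) := by
  have h := (measurePreserving_arrowProdEquivProdArrow ℝ ℝ (Fin n)
    (fun _ => gaussianReal 0 a) (fun _ => gaussianReal 0 b)).map_eq
  rw [Measure.conv, gaussianSeq, gaussianSeq, ← h, Measure.map_map (by fun_prop)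
    (MeasurableEquiv.measurable _), gaussianSeq]
  have h2 := Measure.pi_map_pi (μ := fun _ : Fin n => (gaussianReal 0 a).prod (gaussianReal 0 b))
    (f := fun _ z => z.1 + z.2) (fun _ => by fun_prop)
  have h3 : (fun _ : Fin n => ((gaussianReal 0 a).prod (gaussianReal 0 b)).map
      (fun z => z.1 + z.2)) = fun _ => gaussianReal 0 (a + b) := by
    funext t
    have := gaussianReal_conv_gaussianReal (m₁ := 0) (m₂ := 0) (v₁ := a) (v₂ := b)
    rwa [add_zero] at this
  rw [h3] at h2
  rw [← h2]
  rfl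

lemma gaussianSeq_map_smul (v : ℝ≥0) (c : ℝ) :
    (gaussianSeq n v).map (fun x => c • x) = gaussianSeq n (⟨c ^ 2, sq_nonneg _⟩ * v) := by
  have h2 := Measure.pi_map_pi (μ := fun _ : Fin n => gaussianReal 0 v)
    (f := fun _ z => c * z) (fun _ => by fun_prop)
  simp only [gaussianReal_map_const_mul, mul_zero] at h2
  exact h2

lemma map_eval_gaussianSeq (v : ℝ≥0) (t : Fin n) :
    (gaussianSeq n v).map (fun x => x t) = gaussianReal 0 v :=
  (measurePreserving_eval (fun _ : Fin n => gaussianReal 0 v) t).map_eq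

end Wiretap

namespace Wiretap

/-! ### Adding independent noise with a density. -/

section Noise

variable {Ω α G : Type*} [MeasurableSpace Ω] [MeasurableSpace α] {μ : Measure Ω}

/-- Integration against the joint law of `A` and `s A + N`, for a noise `N` with density `k` that
is independent of `A`. -/
lemma lintegral_add_noise [IsProbabilityMeasure μ] [AddCommGroup G] [MeasureSpace G]
    [MeasurableAdd₂ G] [MeasurableSub₂ G] [SFinite (volume : Measure G)]
    [(volume : Measure G).IsAddLeftInvariant]
    {A : Ω → α} {N : Ω → G} (hA : Measurable A) (hN : Measurable N) (hAN : IndepFun A N μ)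
    {k : G → ℝ≥0∞} (hk : Measurable k) (hlaw : μ.map N = volume.withDensity k)
    {s : α → G} (hs : Measurable s) {F : α × G → ℝ≥0∞} (hF : Measurable F) :
    ∫⁻ ω, F (A ω, s (A ω) + N ω) ∂μ =
      ∫⁻ a, ∫⁻ z, F (a, z) * k (z - s a) ∂volume ∂(μ.map A) := by
  have h1 := lintegral_map (μ := μ) (f := fun p : α × G => F (p.1, s p.1 + p.2))
    (g := fun ω => (A ω, N ω)) (by fun_prop) (by fun_prop)
  have hprob : IsProbabilityMeasure (μ.map N) := Measure.isProbabilityMeasure_map hN.aemeasurable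
  rw [← h1, hAN.map_prod_eq_prod_map_map hA.aemeasurable hN.aemeasurable,
    lintegral_prod _ (by fun_prop)]
  refine lintegral_congr fun a => ?_
  rw [hlaw, lintegral_withDensity_eq_lintegral_mul _ hk (by fun_prop),
    ← lintegral_add_left_eq_self (fun z => F (a, z) * k (z - s a)) (s a)]
  refine lintegral_congr fun z => ?_
  rw [Pi.mul_apply, add_sub_cancel_left, mul_comm]

variable {n : ℕ}

lemma lintegral_gaussianDensity_lt_top {L : Measure α} [IsFiniteMeasure L] (v : ℝ≥0)
    (φ : α → Fin n → ℝ) : ∫⁻ a, ENNReal.ofReal (gaussianDensity v (φ a)) ∂L < ∞ := by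
  refine lt_of_le_of_lt (lintegral_mono fun a =>
    ENNReal.ofReal_le_ofReal (gaussianDensity_le v (φ a))) ?_
  rw [lintegral_const]
  exact ENNReal.mul_lt_top ENNReal.ofReal_lt_top (measure_lt_top _ _)

lemma lintegral_gaussianDensity_pos {L : Measure α} (hL : L ≠ 0) {v : ℝ≥0} (hv : v ≠ 0)
    {φ : α → Fin n → ℝ} (hφ : Measurable φ) :
    0 < ∫⁻ a, ENNReal.ofReal (gaussianDensity v (φ a)) ∂L := by
  rw [lintegral_pos_iff_support (by fun_prop)]
  have : Function.support (fun a => ENNReal.ofReal (gaussianDensity v (φ a))) = Set.univ := by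
    ext a
    simp [gaussianDensity_pos hv]
  rw [this]
  exact (Measure.measure_univ_pos).2 hL

lemma integrable_sq_of_map_eq_gaussianSeq {N : Ω → Fin n → ℝ} (hN : Measurable N) {v : ℝ≥0}
    (hlaw : μ.map N = gaussianSeq n v) (t : Fin n) :
    Integrable (fun ω => N ω t ^ 2) μ ∧ ∫ ω, N ω t ^ 2 ∂μ = v := by
  have h0 : μ.map (fun ω => N ω t) = gaussianReal 0 v := by
    rw [← map_eval_gaussianSeq v t, ← hlaw, Measure.map_map (by fun_prop) hN]
    rfl
  have hm : Measurable fun ω => N ω t := by fun_prop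
  have h1 : Integrable (fun x : ℝ => x ^ 2) (gaussianReal 0 v) :=
    (memLp_two_iff_integrable_sq (Measurable.aestronglyMeasurable (by fun_prop))).1
      (memLp_id_gaussianReal 2)
  have h2 : ∫ x : ℝ, x ^ 2 ∂gaussianReal 0 v = v := by
    have := variance_fun_id_gaussianReal (μ := 0) (v := v)
    rwa [variance_of_integral_eq_zero (by fun_prop) (by simp)] at this
  rw [← h0] at h1 h2
  rw [integral_map hm.aemeasurable (Measurable.aestronglyMeasurable (by fun_prop))] at h2
  exact ⟨(integrable_map_measure (Measurable.aestronglyMeasurable (by fun_prop))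
    hm.aemeasurable).1 h1, h2⟩

lemma integrable_add_sq {f g : Ω → ℝ} (hf : Measurable f) (hg : Measurable g)
    (hf2 : Integrable (fun ω => f ω ^ 2) μ) (hg2 : Integrable (fun ω => g ω ^ 2) μ) :
    Integrable (fun ω => (f ω + g ω) ^ 2) μ :=
  (memLp_two_iff_integrable_sq (by fun_prop)).1
    (((memLp_two_iff_integrable_sq (by fun_prop)).2 hf2).add
      ((memLp_two_iff_integrable_sq (by fun_prop)).2 hg2))

/-- Gaussian smoothing produces a regular law. -/
lemma exists_isRegularLaw_add [IsProbabilityMeasure μ] {X N : Ω → Fin n → ℝ}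
    (hX : Measurable X) (hN : Measurable N)
    (hXN : IndepFun X N μ) {v : ℝ≥0} (hv : v ≠ 0) (hlaw : μ.map N = gaussianSeq n v)
    (hsq : ∀ t, Integrable (fun ω => X ω t ^ 2) μ) :
    ∃ f, IsRegularLaw (μ.map fun ω => X ω + N ω) f := by
  have hprob : IsProbabilityMeasure (μ.map X) := Measure.isProbabilityMeasure_map hX.aemeasurable
  have hlt := fun y => lintegral_gaussianDensity_lt_top (L := μ.map X) v fun x => y - x
  have hm : Measurable fun y : Fin n → ℝ =>
      ∫⁻ x, ENNReal.ofReal (gaussianDensity v (y - x)) ∂(μ.map X) :=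
    Measurable.lintegral_prod_right' (f := fun p : (Fin n → ℝ) × (Fin n → ℝ) =>
      ENNReal.ofReal (gaussianDensity v (p.1 - p.2))) (by fun_prop)
  -- The density is the Gaussian kernel averaged over the law of `X`, hence positive and bounded by
  -- the maximum of the kernel.
  refine ⟨fun y => (∫⁻ x, ENNReal.ofReal (gaussianDensity v (y - x)) ∂(μ.map X)).toReal,
    Measure.isProbabilityMeasure_map (by fun_prop), hm.ennreal_toReal, fun y => ?_,
    ⟨(√(2 * Real.pi * v))⁻¹ ^ n, fun y => ?_⟩, ?_, fun t => ?_⟩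
  · exact ENNReal.toReal_pos (lintegral_gaussianDensity_pos (NeZero.ne _) hv (by fun_prop)).ne'
      (hlt y).ne
  · refine ENNReal.toReal_le_of_le_ofReal (by positivity) ?_
    refine (lintegral_mono fun a => ENNReal.ofReal_le_ofReal (gaussianDensity_le v _)).trans ?_
    simp
  · refine Measure.ext_of_lintegral _ fun F hF => ?_
    simp_rw [fun y => ENNReal.ofReal_toReal (hlt y).ne]
    have h1 := lintegral_add_noise (s := id) (F := fun p => F p.2) hX hN
      hXN (k := fun x => ENNReal.ofReal (gaussianDensity v x)) (by fun_prop)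
      (by rw [hlaw, gaussianSeq_eq_withDensity hv]) measurable_id (by fun_prop)
    simp only [id] at h1
    rw [lintegral_map hF (by fun_prop), h1,
      lintegral_withDensity_eq_lintegral_mul _ hm hF, lintegral_lintegral_swap]
    · refine lintegral_congr fun y => ?_
      rw [Pi.mul_apply, lintegral_const_mul _ (by fun_prop), mul_comm]
    · exact Measurable.aemeasurable (by unfold Function.uncurry; fun_prop)
  · rw [integrable_map_measure (Measurable.aestronglyMeasurable (by fun_prop)) (by fun_prop)]
    exact integrable_add_sq (by fun_prop) (by fun_prop) (hsq t)
      (integrable_sq_of_map_eq_gaussianSeq hN hlaw t).1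

end Noise

/-! ### Independence of inputs and noises, and the joint noise density. -/

namespace Scheme

variable {M n m : ℕ} {v : Fin (M + 1) → ℝ≥0} {Ω : Type*} [mΩ : MeasurableSpace Ω] {μ : Measure Ω}

attribute [fun_prop] measurable_W measurable_X measurable_N₁ measurable_N₂ measurable_Nt

@[fun_prop]
lemma measurable_Y₁ (S : Scheme M n m v μ) (h : Fin (M + 1) → ℝ) : Measurable (S.Y₁ h) :=
  (Finset.measurable_sum _ fun i _ => (S.measurable_X i).const_smul (h i)).add S.measurable_N₁

@[fun_prop]
lemma measurable_Y₂ (S : Scheme M n m v μ) (g : Fin (M + 1) → ℝ) : Measurable (S.Y₂ g) :=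
  (Finset.measurable_sum _ fun i _ => (S.measurable_X i).const_smul (g i)).add S.measurable_N₂

@[fun_prop]
lemma measurable_Xt (S : Scheme M n m v μ) (i : Fin (M + 1)) : Measurable (S.Xt i) :=
  (S.measurable_X i).add (S.measurable_Nt i)

/-- The σ-algebras generated by the mutually independent objects of a scheme. -/
@[reducible]
def sigmaAlgebra (S : Scheme M n m v μ) :
    Fin (M + 1) ⊕ Fin 2 ⊕ Fin (M + 1) → MeasurableSpace Ω :=
  Sum.elim
    (fun i : Fin (M + 1) =>
      if i = 0 then MeasurableSpace.comap (fun ω => (S.W ω, S.X 0 ω)) inferInstance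
      else MeasurableSpace.comap (S.X i) inferInstance)
    (Sum.elim
      ![MeasurableSpace.comap S.N₁ inferInstance, MeasurableSpace.comap S.N₂ inferInstance]
      (fun i : Fin (M + 1) => MeasurableSpace.comap (S.Nt i) inferInstance))

variable (S : Scheme M n m v μ)

lemma sigmaAlgebra_inl_zero : S.sigmaAlgebra (Sum.inl 0) =
    MeasurableSpace.comap (fun ω => (S.W ω, S.X 0 ω)) inferInstance := by
  simp [sigmaAlgebra]

lemma sigmaAlgebra_inl {i : Fin (M + 1)} (hi : i ≠ 0) : S.sigmaAlgebra (Sum.inl i) =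
    MeasurableSpace.comap (S.X i) inferInstance := by
  simp [sigmaAlgebra, hi]

lemma sigmaAlgebra_le (i : Fin (M + 1) ⊕ Fin 2 ⊕ Fin (M + 1)) :
    S.sigmaAlgebra i ≤ mΩ := by
  rcases i with i | i | i
  · by_cases hi : i = 0
    · subst hi
      rw [sigmaAlgebra_inl_zero]
      exact (S.measurable_W.prodMk (S.measurable_X 0)).comap_le
    · rw [S.sigmaAlgebra_inl hi]
      exact (S.measurable_X i).comap_le
  · fin_cases i
    · exact S.measurable_N₁.comap_le
    · exact S.measurable_N₂.comap_le
  · exact (S.measurable_Nt i).comap_le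

/-- Independence statements are reduced to measurability: it suffices that the two functions depend
on disjoint groups of the independent objects. -/
lemma indepFun_of_disjoint {β γ : Type*} [MeasurableSpace β] [MeasurableSpace γ]
    (s t : Set (Fin (M + 1) ⊕ Fin 2 ⊕ Fin (M + 1))) (hst : Disjoint s t) {f : Ω → β} {g : Ω → γ}
    (hf : Measurable[⨆ i ∈ s, S.sigmaAlgebra i] f)
    (hg : Measurable[⨆ i ∈ t, S.sigmaAlgebra i] g) : IndepFun f g μ := by
  rw [IndepFun_iff_Indep]
  exact indep_of_indep_of_le (indep_iSup_of_disjoint S.sigmaAlgebra_le S.indep hst)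
    hf.comap_le hg.comap_le

variable {s : Set (Fin (M + 1) ⊕ Fin 2 ⊕ Fin (M + 1))}

lemma measurable_of_mem {β : Type*} [MeasurableSpace β] {f : Ω → β}
    {i : Fin (M + 1) ⊕ Fin 2 ⊕ Fin (M + 1)} (hi : i ∈ s) (hf : Measurable[S.sigmaAlgebra i] f) :
    Measurable[⨆ i ∈ s, S.sigmaAlgebra i] f :=
  hf.mono (le_biSup S.sigmaAlgebra hi) le_rfl

lemma measurable_W_iSup (hs : Sum.inl 0 ∈ s) : Measurable[⨆ i ∈ s, S.sigmaAlgebra i] S.W :=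
  S.measurable_of_mem hs (by
    rw [sigmaAlgebra_inl_zero]
    exact measurable_fst.comp (comap_measurable _))

lemma measurable_X_iSup {i : Fin (M + 1)} (hs : Sum.inl i ∈ s) :
    Measurable[⨆ i ∈ s, S.sigmaAlgebra i] (S.X i) :=
  S.measurable_of_mem hs (by
    by_cases hi : i = 0
    · subst hi
      rw [sigmaAlgebra_inl_zero]
      exact measurable_snd.comp (comap_measurable (fun ω => (S.W ω, S.X 0 ω)))
    · rw [S.sigmaAlgebra_inl hi]
      exact comap_measurable _)

lemma measurable_N₁_iSup (hs : Sum.inr (Sum.inl 0) ∈ s) :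
    Measurable[⨆ i ∈ s, S.sigmaAlgebra i] S.N₁ :=
  S.measurable_of_mem hs (comap_measurable _)

lemma measurable_N₂_iSup (hs : Sum.inr (Sum.inl 1) ∈ s) :
    Measurable[⨆ i ∈ s, S.sigmaAlgebra i] S.N₂ :=
  S.measurable_of_mem hs (comap_measurable _)

lemma measurable_Nt_iSup {i : Fin (M + 1)} (hs : Sum.inr (Sum.inr i) ∈ s) :
    Measurable[⨆ i ∈ s, S.sigmaAlgebra i] (S.Nt i) :=
  S.measurable_of_mem hs (comap_measurable _)

/-- The message and all the channel inputs. -/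
def input (ω : Ω) : Fin m × (Fin (M + 1) → Fin n → ℝ) := (S.W ω, fun i => S.X i ω)

/-- All the noises. -/
def noise (ω : Ω) : (Fin n → ℝ) × (Fin n → ℝ) × (Fin (M + 1) → Fin n → ℝ) :=
  (S.N₁ ω, S.N₂ ω, fun i => S.Nt i ω)

@[fun_prop]
lemma measurable_input : Measurable S.input := by unfold input; fun_prop

@[fun_prop]
lemma measurable_noise : Measurable S.noise := by unfold noise; fun_prop

lemma measurable_input_iSup :
    Measurable[⨆ i ∈ Set.range Sum.inl, S.sigmaAlgebra i] S.input :=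
  (S.measurable_W_iSup (s := Set.range Sum.inl) ⟨0, rfl⟩).prodMk
    (@measurable_pi_lambda _ _ _ (_) _ _ fun i => S.measurable_X_iSup ⟨i, rfl⟩)

lemma indepFun_input_noise : IndepFun S.input S.noise μ := by
  refine S.indepFun_of_disjoint (Set.range Sum.inl) (Set.range Sum.inr)
    Set.isCompl_range_inl_range_inr.disjoint S.measurable_input_iSup ?_
  exact (S.measurable_N₁_iSup (s := Set.range Sum.inr) ⟨_, rfl⟩).prodMk
    ((S.measurable_N₂_iSup (s := Set.range Sum.inr) ⟨_, rfl⟩).prodMk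
      (@measurable_pi_lambda _ _ _ (_) _ _ fun i => S.measurable_Nt_iSup ⟨_, rfl⟩))

lemma indepFun_input_N₂ : IndepFun S.input S.N₂ μ :=
  S.indepFun_input_noise.comp measurable_id (measurable_fst.comp measurable_snd)

lemma indepFun_X_Nt (i : Fin (M + 1)) : IndepFun (S.X i) (S.Nt i) μ :=
  S.indepFun_input_noise.comp
    (φ := fun a : Fin m × (Fin (M + 1) → Fin n → ℝ) => a.2 i)
    (ψ := fun z : (Fin n → ℝ) × (Fin n → ℝ) × (Fin (M + 1) → Fin n → ℝ) => z.2.2 i)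
    (by fun_prop) (by fun_prop)

/-- The density of the joint law of the noises. -/
noncomputable def noiseDensity (v : Fin (M + 1) → ℝ≥0)
    (z : (Fin n → ℝ) × (Fin n → ℝ) × (Fin (M + 1) → Fin n → ℝ)) : ℝ≥0∞ :=
  ENNReal.ofReal (gaussianDensity 1 z.1) * (ENNReal.ofReal (gaussianDensity 1 z.2.1) *
    ENNReal.ofReal (∏ i, gaussianDensity (v i) (z.2.2 i)))

@[fun_prop]
lemma measurable_noiseDensity (v : Fin (M + 1) → ℝ≥0) :
    Measurable (noiseDensity (n := n) v) := by
  unfold noiseDensity; fun_prop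

lemma map_noise [IsProbabilityMeasure μ] (hv : ∀ i, v i ≠ 0) :
    μ.map S.noise = volume.withDensity (noiseDensity v) := by
  have h1 : IndepFun S.N₁ (fun ω => (S.N₂ ω, fun i => S.Nt i ω)) μ := by
    refine S.indepFun_of_disjoint {Sum.inr (Sum.inl 0)} {Sum.inr (Sum.inl 0)}ᶜ
      disjoint_compl_right (S.measurable_N₁_iSup rfl) ?_
    exact (S.measurable_N₂_iSup (by simp)).prodMk
      (@measurable_pi_lambda _ _ _ (_) _ _ fun i => S.measurable_Nt_iSup (by simp))
  have h2 : IndepFun S.N₂ (fun ω i => S.Nt i ω) μ := by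
    refine S.indepFun_of_disjoint {Sum.inr (Sum.inl 1)} {Sum.inr (Sum.inl 1)}ᶜ
      disjoint_compl_right (S.measurable_N₂_iSup rfl) ?_
    exact @measurable_pi_lambda _ _ _ (_) _ _ fun i => S.measurable_Nt_iSup (by simp)
  have h3 : iIndepFun S.Nt μ :=
    S.indep.precomp (g := Sum.inr ∘ Sum.inr) (Sum.inr_injective.comp Sum.inr_injective)
  have h4 := h3.map_fun_eq_pi_map fun i => (S.measurable_Nt i).aemeasurable
  simp_rw [S.law_Nt, fun i => gaussianSeq_eq_withDensity (n := n) (hv i)] at h4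
  rw [pi_withDensity (fun i => integrable_gaussianDensity (v i))
    fun i x => (gaussianDensity_pos (hv i) x).le] at h4
  have e1 := h1.map_prod_eq_prod_map_map (by fun_prop) (by fun_prop)
  rw [h2.map_prod_eq_prod_map_map (by fun_prop) (by fun_prop), h4, S.law_N₁, S.law_N₂,
    gaussianSeq_eq_withDensity one_ne_zero] at e1
  have hp : IsProbabilityMeasure (μ.map fun ω i => S.Nt i ω) :=
    Measure.isProbabilityMeasure_map (by fun_prop)
  rw [h4] at hp
  have hg : IsProbabilityMeasure
      (volume.withDensity fun x : Fin n → ℝ => ENNReal.ofReal (gaussianDensity 1 x)) := by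
    rw [← gaussianSeq_eq_withDensity one_ne_zero]; infer_instance
  rw [prod_withDensity (by fun_prop) (by fun_prop), prod_withDensity (by fun_prop) (by fun_prop)]
    at e1
  exact e1

end Scheme

end Wiretap

namespace Wiretap

namespace Scheme

variable {M n m : ℕ} {v : Fin (M + 1) → ℝ≥0} {Ω : Type*} [mΩ : MeasurableSpace Ω] {μ : Measure Ω}
  (S : Scheme M n m v μ)

/-! ### Entropies of the perturbed inputs and of the eavesdropper's output. -/

section Entropy

lemma integrable_sum_smul_X_sq (hsq : ∀ i t, Integrable (fun ω => S.X i ω t ^ 2) μ)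
    (g : Fin (M + 1) → ℝ) (t : Fin n) :
    Integrable (fun ω => (∑ i, g i • S.X i ω) t ^ 2) μ := by
  have h1 : ∀ i, MemLp (fun ω => S.X i ω t) 2 μ := fun i =>
    (memLp_two_iff_integrable_sq (by fun_prop)).2 (hsq i t)
  have h2 := (memLp_finsetSum Finset.univ fun i _ => (h1 i).const_mul (g i)).integrable_sq
  simpa [Finset.sum_apply] using h2

lemma indepFun_sum_N₂ (g : Fin (M + 1) → ℝ) :
    IndepFun (fun ω => ∑ i, g i • S.X i ω) S.N₂ μ :=
  S.indepFun_input_N₂.comp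
    (φ := fun a : Fin m × (Fin (M + 1) → Fin n → ℝ) => ∑ i, g i • a.2 i) (ψ := id)
    (by fun_prop) measurable_id

variable [IsProbabilityMeasure μ]

lemma exists_isRegularLaw_Xt (hv : ∀ i, v i ≠ 0)
    (hsq : ∀ i t, Integrable (fun ω => S.X i ω t ^ 2) μ) (i : Fin (M + 1)) :
    ∃ f, IsRegularLaw (μ.map (S.Xt i)) f :=
  exists_isRegularLaw_add (S.measurable_X i) (S.measurable_Nt i) (S.indepFun_X_Nt i) (hv i)
    (S.law_Nt i) (hsq i)

lemma exists_isRegularLaw_Y₂ (hsq : ∀ i t, Integrable (fun ω => S.X i ω t ^ 2) μ)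
    (g : Fin (M + 1) → ℝ) : ∃ f, IsRegularLaw (μ.map (S.Y₂ g)) f :=
  exists_isRegularLaw_add (by fun_prop) S.measurable_N₂ (S.indepFun_sum_N₂ g) one_ne_zero
    S.law_N₂ (S.integrable_sum_smul_X_sq hsq g)

/-- A crude bound, linear in `P`. It only serves to choose `ε` in terms of `P`, so its size is
irrelevant. -/
lemma diffEntropy_Xt_le (hv : ∀ i, v i ≠ 0) (hn : 0 < n) {P : ℝ} (hP : S.PowerConstraint P)
    (i : Fin (M + 1)) :
    diffEntropy (μ.map (S.Xt i)) ≤ n * (Real.log (2 * Real.pi) / 2 + (P + v i)) := by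
  obtain ⟨f, hf⟩ := S.exists_isRegularLaw_Xt hv (fun i => (hP i).1) i
  refine hf.diffEntropy_le.trans ?_
  have hn' : (0 : ℝ) < n := by exact_mod_cast hn
  -- The factor two from `(x + y) ^ 2 ≤ 2 x ^ 2 + 2 y ^ 2` cancels the one half in `diffEntropy_le`.
  have h1 : ∀ t, ∫ x, x t ^ 2 ∂(μ.map (S.Xt i)) ≤ 2 * ∫ ω, S.X i ω t ^ 2 ∂μ + 2 * v i := by
    intro t
    have hN := integrable_sq_of_map_eq_gaussianSeq (S.measurable_Nt i) (S.law_Nt i) t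
    rw [integral_map (by fun_prop) (Measurable.aestronglyMeasurable (by fun_prop)), ← hN.2,
      ← integral_const_mul, ← integral_const_mul,
      ← integral_add (((hP i).1 t).const_mul 2) (hN.1.const_mul 2)]
    refine integral_mono_of_nonneg (ae_of_all _ fun ω => sq_nonneg _)
      ((((hP i).1 t).const_mul 2).add (hN.1.const_mul 2)) (ae_of_all _ fun ω => ?_)
    simp only [Xt, Pi.add_apply]
    linarith [add_sq_le (a := S.X i ω t) (b := S.Nt i ω t)]
  have h2 : ∑ t, ∫ x, x t ^ 2 ∂(μ.map (S.Xt i)) ≤ 2 * (n * P) + n * (2 * v i) := by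
    refine (Finset.sum_le_sum fun t _ => h1 t).trans ?_
    rw [Finset.sum_add_distrib, ← Finset.mul_sum]
    have h3 := (hP i).2
    rw [one_div, inv_mul_le_iff₀ hn'] at h3
    simp only [Finset.sum_const, Finset.card_univ, Fintype.card_fin, nsmul_eq_mul]
    linarith
  linarith

/-- The output of the eavesdropper is noisier than each of its perturbed inputs. -/
lemma diffEntropy_Xt_le_diffEntropy_Y₂ (hv : ∀ i, v i ≠ 0)
    (hsq : ∀ i t, Integrable (fun ω => S.X i ω t ^ 2) μ) {g : Fin (M + 1) → ℝ} {j : Fin (M + 1)}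
    (hg : g j ≠ 0) (hgv : (v j : ℝ) < 1 / g j ^ 2) :
    diffEntropy (μ.map (S.Xt j)) + n * Real.log |g j| ≤ diffEntropy (μ.map (S.Y₂ g)) := by
  obtain ⟨f, hf⟩ := S.exists_isRegularLaw_Xt hv hsq j
  obtain ⟨p, hp⟩ := S.exists_isRegularLaw_Y₂ hsq g
  have hle : g j ^ 2 * v j ≤ 1 := by
    rw [lt_div_iff₀ (by positivity)] at hgv
    linarith
  -- This is the variance of `g j • Nt j`. As it is at most one, the truncated difference `1 - a` is
  -- a genuine one.
  set a : ℝ≥0 := ⟨g j ^ 2, sq_nonneg _⟩ * v j with ha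
  have hab : a + (1 - a) = 1 := add_tsub_cancel_of_le hle
  have hrest : IndepFun (fun ω => g j • S.X j ω)
      (fun ω => ∑ i ∈ Finset.univ.erase j, g i • S.X i ω) μ := by
    refine S.indepFun_of_disjoint {Sum.inl j} {Sum.inl j}ᶜ disjoint_compl_right ?_ ?_
    · exact (S.measurable_X_iSup (s := {Sum.inl j}) rfl).const_smul (g j)
    · refine @Finset.measurable_sum _ _ _ _ _ _ (_) _ _ fun i hi => ?_
      refine Measurable.const_smul (S.measurable_X_iSup (s := {Sum.inl j}ᶜ) ?_) (g i)
      simpa using Finset.ne_of_mem_erase hi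
  have hX : IndepFun (fun ω => g j • S.X j ω) (fun ω => g j • S.Nt j ω) μ :=
    (S.indepFun_X_Nt j).comp (φ := fun x => g j • x) (ψ := fun x => g j • x)
      (by fun_prop) (by fun_prop)
  have e1 : (μ.map (S.Xt j)).map (fun x => g j • x) =
      (μ.map fun ω => g j • S.X j ω).conv (gaussianSeq n a) := by
    have h1 := hX.map_add_eq_map_conv_map (by fun_prop) (by fun_prop)
    have h2 : μ.map (fun ω => g j • S.Nt j ω) = gaussianSeq n a := by
      rw [ha, ← gaussianSeq_map_smul, ← S.law_Nt j, Measure.map_map (by fun_prop) (by fun_prop)]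
      rfl
    rw [h2] at h1
    rw [← h1, Measure.map_map (by fun_prop) (by fun_prop)]
    congr 1
    ext ω t
    simp [Xt, mul_add]
  -- The splitting holds in law only: the noise of variance one is the convolution of variances `a`
  -- and `1 - a`, and the first part turns `g j • X j` into a copy of `g j • Xt j`.
  have e2 : μ.map (S.Y₂ g) = ((μ.map (S.Xt j)).map (fun x => g j • x)).conv
      ((μ.map fun ω => ∑ i ∈ Finset.univ.erase j, g i • S.X i ω).conv
        (gaussianSeq n (1 - a))) := by
    have h1 := (S.indepFun_sum_N₂ g).map_add_eq_map_conv_map (by fun_prop) (by fun_prop)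
    have h2 := hrest.map_add_eq_map_conv_map (by fun_prop) (by fun_prop)
    have h3 : (fun ω => ∑ i, g i • S.X i ω) = (fun ω => g j • S.X j ω) +
        fun ω => ∑ i ∈ Finset.univ.erase j, g i • S.X i ω := by
      ext1 ω
      exact (Finset.add_sum_erase _ _ (Finset.mem_univ j)).symm
    have h4 : S.Y₂ g = (fun ω => ∑ i, g i • S.X i ω) + S.N₂ := rfl
    rw [h4, h1, h3, h2, S.law_N₂, e1, ← hab, ← gaussianSeq_conv, hab]
    have p1 : IsProbabilityMeasure (μ.map fun ω => g j • S.X j ω) :=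
      Measure.isProbabilityMeasure_map (by fun_prop)
    have p2 : IsProbabilityMeasure
        (μ.map fun ω => ∑ i ∈ Finset.univ.erase j, g i • S.X i ω) :=
      Measure.isProbabilityMeasure_map (by fun_prop)
    generalize (μ.map fun ω => g j • S.X j ω) = A at *
    generalize (μ.map fun ω => ∑ i ∈ Finset.univ.erase j, g i • S.X i ω) = B at *
    rw [Measure.conv_assoc, Measure.conv_assoc, ← Measure.conv_assoc B,
      ← Measure.conv_assoc (gaussianSeq n a), Measure.conv_comm B]
  have p3 : IsProbabilityMeasure
      ((μ.map fun ω => ∑ i ∈ Finset.univ.erase j, g i • S.X i ω).conv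
        (gaussianSeq n (1 - a))) := by
    have : IsProbabilityMeasure
        (μ.map fun ω => ∑ i ∈ Finset.univ.erase j, g i • S.X i ω) :=
      Measure.isProbabilityMeasure_map (by fun_prop)
    infer_instance
  rw [e2] at hp ⊢
  rw [← hf.diffEntropy_smul hg]
  exact (hf.smul hg).diffEntropy_le_conv hp

end Entropy

/-! ### The joint density of message and eavesdropper output, and mutual information. -/

section Conditional

/-- The noiseless linear combination seen by a receiver. -/
def combine (g : Fin (M + 1) → ℝ) (a : Fin m × (Fin (M + 1) → Fin n → ℝ)) : Fin n → ℝ :=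
  ∑ i, g i • a.2 i

@[fun_prop]
lemma measurable_combine (g : Fin (M + 1) → ℝ) : Measurable (combine (n := n) (m := m) g) := by
  unfold combine; fun_prop

lemma lintegral_fst_mul {α : Type*} [MeasurableSpace α] (L : Measure (Fin m × α))
    (φ : Fin m → ℝ≥0∞) {k : Fin m × α → ℝ≥0∞} (hk : Measurable k) :
    ∫⁻ a, φ a.1 * k a ∂L = ∑ w, φ w * ∫⁻ a in {a | a.1 = w}, k a ∂L := by
  have hs : ∀ w : Fin m, MeasurableSet {a : Fin m × α | a.1 = w} := fun w =>
    measurable_fst (measurableSet_singleton w)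
  have h1 : ∀ a : Fin m × α, φ a.1 * k a =
      ∑ w, φ w * {a : Fin m × α | a.1 = w}.indicator k a := fun a => by
    rw [Finset.sum_eq_single a.1]
    · simp
    · intro w _ hw
      simp [Set.indicator, hw.symm]
    · simp
  simp_rw [h1]
  rw [lintegral_finsetSum _ fun w _ => ((hk.indicator (hs w)).const_mul _)]
  refine Finset.sum_congr rfl fun w _ => ?_
  rw [lintegral_const_mul _ (hk.indicator (hs w)), lintegral_indicator (hs w)]

/-- The sub-density of `Y₂` on the event `W = w`. -/
noncomputable def partDensity (g : Fin (M + 1) → ℝ) (w : Fin m) (y : Fin n → ℝ) : ℝ≥0∞ :=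
  ∫⁻ a in {a | a.1 = w}, ENNReal.ofReal (gaussianDensity 1 (y - combine g a)) ∂(μ.map S.input)

lemma measurable_partDensity [IsProbabilityMeasure μ] (g : Fin (M + 1) → ℝ) :
    Measurable fun q : Fin m × (Fin n → ℝ) => S.partDensity g q.1 q.2 := by
  refine measurable_from_prod_countable_right fun w => ?_
  have : IsProbabilityMeasure (μ.map S.input) := Measure.isProbabilityMeasure_map (by fun_prop)
  exact Measurable.lintegral_prod_right' (ν := (μ.map S.input).restrict {a | a.1 = w})
    (f := fun p : (Fin n → ℝ) × (Fin m × (Fin (M + 1) → Fin n → ℝ)) =>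
      ENNReal.ofReal (gaussianDensity 1 (p.1 - combine g p.2))) (by fun_prop)

variable [IsProbabilityMeasure μ]

lemma partDensity_lt_top (g : Fin (M + 1) → ℝ) (w : Fin m) (y : Fin n → ℝ) :
    S.partDensity g w y < ∞ := by
  have : IsProbabilityMeasure (μ.map S.input) := Measure.isProbabilityMeasure_map (by fun_prop)
  exact lintegral_gaussianDensity_lt_top 1 fun a => y - combine g a

lemma measure_W (w : Fin m) : μ (S.W ⁻¹' {w}) = (m : ℝ≥0∞)⁻¹ := by
  have hm : (0 : ℝ) < m := by exact_mod_cast w.pos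
  rw [← ofReal_measureReal, S.uniform_W w, one_div, ENNReal.ofReal_inv_of_pos hm,
    ENNReal.ofReal_natCast]

/-- The uniform message gives every event `W = w` positive mass, and the Gaussian kernel vanishes
nowhere. -/
lemma partDensity_pos (g : Fin (M + 1) → ℝ) (w : Fin m) (y : Fin n → ℝ) :
    0 < S.partDensity g w y := by
  refine lintegral_gaussianDensity_pos ?_ one_ne_zero (by fun_prop)
  have hs : MeasurableSet {a : Fin m × (Fin (M + 1) → Fin n → ℝ) | a.1 = w} :=
    measurable_fst (measurableSet_singleton w)
  rw [Ne, Measure.restrict_eq_zero, Measure.map_apply (by fun_prop) hs]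
  exact (S.measure_W w).trans_ne (by simp)

/-- Identifies `partDensity` as the density of `(W, Y₂)` with respect to counting measure times
Lebesgue measure. -/
lemma lintegral_W_Y₂ (g : Fin (M + 1) → ℝ) {F : Fin m × (Fin n → ℝ) → ℝ≥0∞}
    (hF : Measurable F) :
    ∫⁻ ω, F (S.W ω, S.Y₂ g ω) ∂μ = ∑ w, ∫⁻ y, F (w, y) * S.partDensity g w y := by
  have : IsProbabilityMeasure (μ.map S.input) := Measure.isProbabilityMeasure_map (by fun_prop)
  have h1 := lintegral_add_noise S.measurable_input S.measurable_N₂ S.indepFun_input_N₂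
    (k := fun x => ENNReal.ofReal (gaussianDensity 1 x)) (by fun_prop)
    (by rw [S.law_N₂, gaussianSeq_eq_withDensity one_ne_zero]) (measurable_combine g)
    (F := fun p => F (p.1.1, p.2)) (by fun_prop)
  rw [lintegral_lintegral_swap (Measurable.aemeasurable (by unfold Function.uncurry; fun_prop))]
    at h1
  have h2 : ∀ y, ∫⁻ a, F (a.1, y) * ENNReal.ofReal (gaussianDensity 1 (y - combine g a))
      ∂(μ.map S.input) = ∑ w, F (w, y) * S.partDensity g w y := fun y =>
    lintegral_fst_mul (μ.map S.input) (fun w => F (w, y)) (by fun_prop)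
  have hp := S.measurable_partDensity g
  have hp' : ∀ w, Measurable (S.partDensity g w) := fun w => hp.comp measurable_prodMk_left
  simp_rw [h2] at h1
  rw [← lintegral_finsetSum _ fun w _ => by have := hp' w; fun_prop]
  exact h1

/-- The information density of `(W, Y₂)` is integrable, and its mean is `I(W; Y₂)`. -/
lemma integral_information_density (g : Fin (M + 1) → ℝ) {f : (Fin n → ℝ) → ℝ}
    (hf : IsRegularLaw (μ.map (S.Y₂ g)) f) (hI : mutualInfo μ S.W (S.Y₂ g) ≠ ∞) :
    Integrable (fun ω => Real.log (m * (S.partDensity g (S.W ω) (S.Y₂ g ω)).toReal /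
      f (S.Y₂ g ω))) μ ∧
    ∫ ω, Real.log (m * (S.partDensity g (S.W ω) (S.Y₂ g ω)).toReal / f (S.Y₂ g ω)) ∂μ =
      (mutualInfo μ S.W (S.Y₂ g)).toReal := by
  have hfm := hf.measurable
  have hp := S.measurable_partDensity g
  have hp' : ∀ w, Measurable (S.partDensity g w) := fun w => hp.comp measurable_prodMk_left
  -- The density of the joint law of `(W, Y₂)` with respect to the product of its marginals; the
  -- factor `m` is the inverse of the uniform mass of a message.
  set ρ : Fin m × (Fin n → ℝ) → ℝ := fun q => m * (S.partDensity g q.1 q.2).toReal / f q.2 with hρ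
  have hρm : Measurable ρ := by fun_prop
  have pW : IsProbabilityMeasure (μ.map S.W) := Measure.isProbabilityMeasure_map (by fun_prop)
  have pY : IsProbabilityMeasure (μ.map (S.Y₂ g)) := hf.prob
  have pJ : IsProbabilityMeasure (μ.map fun ω => (S.W ω, S.Y₂ g ω)) :=
    Measure.isProbabilityMeasure_map (by fun_prop)
  have hJ : μ.map (fun ω => (S.W ω, S.Y₂ g ω)) =
      ((μ.map S.W).prod (μ.map (S.Y₂ g))).withDensity fun q => ENNReal.ofReal (ρ q) := by
    refine Measure.ext_of_lintegral _ fun F hF => ?_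
    rw [lintegral_map hF (by fun_prop), S.lintegral_W_Y₂ g hF,
      lintegral_withDensity_eq_lintegral_mul _ (by fun_prop) hF,
      lintegral_prod _ (by fun_prop), lintegral_fintype]
    refine Finset.sum_congr rfl fun w _ => ?_
    rw [Measure.map_apply S.measurable_W (measurableSet_singleton w), S.measure_W w, mul_comm,
      hf.eq_withDensity, lintegral_withDensity_eq_lintegral_mul _ (by fun_prop) (by fun_prop),
      ← lintegral_const_mul _ (by fun_prop)]
    refine lintegral_congr fun y => ?_
    have hm : (0 : ℝ) < m := by exact_mod_cast w.pos
    simp only [Pi.mul_apply, hρ]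
    rw [← mul_assoc (ENNReal.ofReal (f y)), ← ENNReal.ofReal_mul (hf.pos y).le,
      mul_div_cancel₀ _ (hf.pos y).ne', ENNReal.ofReal_mul hm.le, ENNReal.ofReal_natCast,
      ENNReal.ofReal_toReal (S.partDensity_lt_top g w y).ne, mul_assoc, ← mul_assoc,
      ENNReal.inv_mul_cancel (by simpa using hm.ne') (by simp), one_mul, mul_comm]
  obtain ⟨hac, hint⟩ := InformationTheory.klDiv_ne_top_iff.1 hI
  have hllr : llr (μ.map fun ω => (S.W ω, S.Y₂ g ω)) ((μ.map S.W).prod (μ.map (S.Y₂ g)))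
      =ᵐ[μ.map fun ω => (S.W ω, S.Y₂ g ω)] fun q => Real.log (ρ q) := by
    have h1 := Measure.rnDeriv_withDensity ((μ.map S.W).prod (μ.map (S.Y₂ g)))
      hρm.ennreal_ofReal
    rw [← hJ] at h1
    filter_upwards [hac.ae_le h1] with q hq
    have hm : (0 : ℝ) < m := by exact_mod_cast q.1.pos
    rw [llr, hq, ENNReal.toReal_ofReal]
    exact div_nonneg (by positivity) (hf.pos _).le
  have hint' := (integrable_congr hllr).1 hint
  refine ⟨(integrable_map_measure (Measurable.aestronglyMeasurable (by fun_prop))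
    (by fun_prop)).1 hint', ?_⟩
  rw [mutualInfo, InformationTheory.toReal_klDiv_of_measure_eq hac (by simp),
    integral_congr_ae hllr, integral_map (by fun_prop)
      (Measurable.aestronglyMeasurable (by fun_prop))]

end Conditional

end Scheme

end Wiretap

namespace Wiretap

namespace Scheme

variable {M n m : ℕ} {v : Fin (M + 1) → ℝ≥0} {Ω : Type*} [mΩ : MeasurableSpace Ω] {μ : Measure Ω}
  (S : Scheme M n m v μ)

/-! ### Mean log-densities of the noises and residual noises. -/

/-- What is left of a noise `N` after removing the fudge noises with gains `a`. -/
def residual (N : Ω → Fin n → ℝ) (a : Fin (M + 1) → ℝ) (ω : Ω) : Fin n → ℝ :=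
  N ω - ∑ i, a i • S.Nt i ω

/-- A bound on the second moment of the residual noises. -/
def residualBound (v : Fin (M + 1) → ℝ≥0) (a : Fin (M + 1) → ℝ) : ℝ :=
  2 + 2 * (∑ i, a i ^ 2) * ∑ i, (v i : ℝ)

variable {S} in
lemma residual_sq {N : Ω → Fin n → ℝ} (hN : Measurable N) (hlaw : μ.map N = gaussianSeq n 1)
    (a : Fin (M + 1) → ℝ) (t : Fin n) :
    Integrable (fun ω => S.residual N a ω t ^ 2) μ ∧
      ∫ ω, S.residual N a ω t ^ 2 ∂μ ≤ residualBound v a := by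
  have hN2 := integrable_sq_of_map_eq_gaussianSeq hN hlaw t
  have hNt := fun i => integrable_sq_of_map_eq_gaussianSeq (S.measurable_Nt i) (S.law_Nt i) t
  have hle : ∀ ω, S.residual N a ω t ^ 2 ≤
      2 * N ω t ^ 2 + 2 * (∑ i, a i ^ 2) * ∑ i, S.Nt i ω t ^ 2 := fun ω => by
    -- Cauchy–Schwarz makes a bound on the residual possible from the individual second moments,
    -- without using independence.
    have h1 := Finset.sum_mul_sq_le_sq_mul_sq Finset.univ a fun i => S.Nt i ω t
    have h2 := add_sq_le (a := N ω t) (b := -∑ i, a i * S.Nt i ω t)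
    simp only [residual, Pi.sub_apply, Finset.sum_apply, Pi.smul_apply, smul_eq_mul]
    rw [sub_eq_add_neg]
    linarith [neg_sq (∑ i, a i * S.Nt i ω t)]
  have hint : Integrable (fun ω => 2 * N ω t ^ 2 +
      2 * (∑ i, a i ^ 2) * ∑ i, S.Nt i ω t ^ 2) μ :=
    (hN2.1.const_mul 2).add ((integrable_finsetSum _ fun i _ => (hNt i).1).const_mul _)
  have hm : Measurable fun ω => S.residual N a ω t ^ 2 := by
    have : Measurable (S.residual N a) := by unfold residual; fun_prop
    fun_prop
  have hres : Integrable (fun ω => S.residual N a ω t ^ 2) μ :=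
    hint.mono' hm.aestronglyMeasurable (ae_of_all _ fun ω => by
      rw [Real.norm_of_nonneg (sq_nonneg _)]
      exact hle ω)
  refine ⟨hres, (integral_mono hres hint hle).trans_eq ?_⟩
  rw [integral_add (hN2.1.const_mul 2)
    ((integrable_finsetSum _ fun i _ => (hNt i).1).const_mul _), integral_const_mul,
    integral_const_mul, integral_finsetSum _ fun i _ => (hNt i).1, hN2.2,
    Finset.sum_congr rfl fun i _ => (hNt i).2, residualBound]
  simp

variable [IsProbabilityMeasure μ]

lemma integral_log_gaussianDensity {N : Ω → Fin n → ℝ} {u : ℝ≥0} (hu : u ≠ 0)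
    (hsq : ∀ t, Integrable (fun ω => N ω t ^ 2) μ) :
    Integrable (fun ω => Real.log (gaussianDensity u (N ω))) μ ∧
    ∫ ω, Real.log (gaussianDensity u (N ω)) ∂μ =
      -(n * (Real.log (2 * Real.pi * u) / 2)) - (∑ t, ∫ ω, N ω t ^ 2 ∂μ) / (2 * u) := by
  simp_rw [log_gaussianDensity hu]
  have h := (integrable_finsetSum Finset.univ fun t _ => hsq t).div_const (2 * (u : ℝ))
  refine ⟨(integrable_const _).sub h, ?_⟩
  rw [integral_sub (integrable_const _) h, integral_div, integral_finsetSum _ fun t _ => hsq t]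
  simp

lemma integral_log_gaussianDensity_noise {N : Ω → Fin n → ℝ} (hN : Measurable N) {u : ℝ≥0}
    (hu : u ≠ 0) (hlaw : μ.map N = gaussianSeq n u) :
    Integrable (fun ω => Real.log (gaussianDensity u (N ω))) μ ∧
    ∫ ω, Real.log (gaussianDensity u (N ω)) ∂μ =
      -(n * (Real.log (2 * Real.pi * u) / 2 + 1 / 2)) := by
  have h := fun t => integrable_sq_of_map_eq_gaussianSeq hN hlaw t
  obtain ⟨h1, h2⟩ := integral_log_gaussianDensity hu fun t => (h t).1
  refine ⟨h1, ?_⟩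
  have hu' : (u : ℝ) ≠ 0 := by simpa using hu
  rw [h2, Finset.sum_congr rfl fun t _ => (h t).2]
  simp only [Finset.sum_const, Finset.card_univ, Fintype.card_fin, nsmul_eq_mul]
  field_simp
  ring

lemma integral_log_gaussianDensity_residual {N : Ω → Fin n → ℝ} (hN : Measurable N)
    (hlaw : μ.map N = gaussianSeq n 1) (a : Fin (M + 1) → ℝ) :
    Integrable (fun ω => Real.log (gaussianDensity 1 (S.residual N a ω))) μ ∧
    -(n * (Real.log (2 * Real.pi) / 2 + residualBound v a / 2)) ≤
      ∫ ω, Real.log (gaussianDensity 1 (S.residual N a ω)) ∂μ := by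
  have h := fun t => residual_sq (S := S) hN hlaw a t
  obtain ⟨h1, h2⟩ := integral_log_gaussianDensity one_ne_zero fun t => (h t).1
  refine ⟨h1, ?_⟩
  have h3 : ∑ t, ∫ ω, S.residual N a ω t ^ 2 ∂μ ≤ n * residualBound v a :=
    (Finset.sum_le_sum fun t _ => (h t).2).trans_eq (by simp)
  rw [h2]
  simp only [NNReal.coe_one, mul_one]
  linarith

/-! ### The decoder as a randomised guess of the message. -/

variable (dec : (Fin n → ℝ) → Fin m)

/-- The guess `w ↦ decWeight dec y w / m` for the law of the message given the output `y`:
the decision of the decoder with weight one half, and a uniform message otherwise. -/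
noncomputable def decWeight (y : Fin n → ℝ) (w : Fin m) : ℝ := if dec y = w then m / 2 else 1 / 2

variable {dec} in
lemma decWeight_pos (y : Fin n → ℝ) (w : Fin m) : 0 < decWeight dec y w := by
  have hm : (0 : ℝ) < m := by exact_mod_cast w.pos
  unfold decWeight
  split_ifs <;> positivity

lemma sum_decWeight_le (y : Fin n → ℝ) : ∑ w, decWeight dec y w ≤ m := by
  have hm : (1 : ℝ) ≤ m := by exact_mod_cast (dec y).pos
  have h1 : ∀ w, decWeight dec y w = (if dec y = w then (m : ℝ) / 2 - 1 / 2 else 0) + 1 / 2 :=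
    fun w => by unfold decWeight; split_ifs <;> ring
  simp_rw [h1, Finset.sum_add_distrib]
  simp
  linarith

variable {dec} in
lemma measurable_decWeight (hdec : Measurable dec) :
    Measurable fun q : (Fin n → ℝ) × Fin m => decWeight dec q.1 q.2 :=
  Measurable.ite (measurableSet_eq_fun (by fun_prop) (by fun_prop)) measurable_const
    measurable_const

variable {dec} in
-- This plays the role of Fano's inequality: the logarithm is `log m - log 2` on correct decoding
-- and `-log 2` otherwise. The uniform half of the guess keeps it finite on errors.
lemma integral_log_decWeight (hdec : Measurable dec) (h : Fin (M + 1) → ℝ) :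
    Integrable (fun ω => Real.log (decWeight dec (S.Y₁ h ω) (S.W ω))) μ ∧
    ∫ ω, Real.log (decWeight dec (S.Y₁ h ω) (S.W ω)) ∂μ =
      (1 - μ.real {ω | dec (S.Y₁ h ω) ≠ S.W ω}) * Real.log m - Real.log 2 := by
  have hs : MeasurableSet {ω | dec (S.Y₁ h ω) = S.W ω} :=
    measurableSet_eq_fun (by fun_prop) (by fun_prop)
  have h1 : ∀ ω, Real.log (decWeight dec (S.Y₁ h ω) (S.W ω)) =
      {ω | dec (S.Y₁ h ω) = S.W ω}.indicator (fun _ => Real.log m) ω - Real.log 2 := fun ω => by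
    have hm : (m : ℝ) ≠ 0 := by exact_mod_cast (S.W ω).pos.ne'
    unfold decWeight
    by_cases hω : dec (S.Y₁ h ω) = S.W ω
    · simp [hω, Real.log_div hm]
    · simp [hω]
  have hi : Integrable ({ω | dec (S.Y₁ h ω) = S.W ω}.indicator fun _ => Real.log m) μ :=
    (integrable_const _).indicator hs
  simp_rw [h1]
  refine ⟨hi.sub (integrable_const _), ?_⟩
  have h2 : μ.real {ω | dec (S.Y₁ h ω) ≠ S.W ω} = 1 - μ.real {ω | dec (S.Y₁ h ω) = S.W ω} :=
    probReal_compl_eq_one_sub hs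
  rw [integral_sub hi (integrable_const _), integral_indicator_const _ hs, h2]
  simp

/-! ### The fictitious joint law and Gibbs' inequality for it. -/

/-- The auxiliary joint density of the outputs and the perturbed inputs. -/
noncomputable def auxDensity (h g : Fin (M + 1) → ℝ) (f : Fin (M + 1) → (Fin n → ℝ) → ℝ)
    (z : (Fin n → ℝ) × (Fin n → ℝ) × (Fin (M + 1) → Fin n → ℝ)) : ℝ :=
  gaussianDensity 1 (z.1 - ∑ i, h i • z.2.2 i) *
    (gaussianDensity 1 (z.2.1 - ∑ i, g i • z.2.2 i) * ∏ i, f i (z.2.2 i))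

/-- Given the perturbed inputs, each output kernel integrates to one; what remains is the total mass
of a product of probability laws. -/
lemma lintegral_auxDensity (h g : Fin (M + 1) → ℝ) {f : Fin (M + 1) → (Fin n → ℝ) → ℝ}
    {ν : Fin (M + 1) → Measure (Fin n → ℝ)} (hf : ∀ i, IsRegularLaw (ν i) (f i)) :
    ∫⁻ z, ENNReal.ofReal (auxDensity h g f z) = 1 := by
  have hfm := fun i => (hf i).measurable
  have hsplit : ∀ z, ENNReal.ofReal (auxDensity h g f z) =
      ENNReal.ofReal (gaussianDensity 1 (z.1 - ∑ i, h i • z.2.2 i)) *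
        (ENNReal.ofReal (gaussianDensity 1 (z.2.1 - ∑ i, g i • z.2.2 i)) *
          ENNReal.ofReal (∏ i, f i (z.2.2 i))) := fun z => by
    rw [auxDensity, ENNReal.ofReal_mul (gaussianDensity_pos one_ne_zero _).le,
      ENNReal.ofReal_mul (gaussianDensity_pos one_ne_zero _).le]
  have hg1 : ∀ x : Fin n → ℝ, ∫⁻ y, ENNReal.ofReal (gaussianDensity 1 (y - x)) = 1 := fun x => by
    rw [lintegral_sub_right_eq_self (fun y => ENNReal.ofReal (gaussianDensity 1 y)) x,
      lintegral_gaussianDensity one_ne_zero]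
  simp_rw [hsplit]
  rw [Measure.volume_eq_prod, lintegral_prod_symm _ (by fun_prop)]
  have h1 : ∀ p : (Fin n → ℝ) × (Fin (M + 1) → Fin n → ℝ),
      ∫⁻ y, ENNReal.ofReal (gaussianDensity 1 (y - ∑ i, h i • p.2 i)) *
        (ENNReal.ofReal (gaussianDensity 1 (p.1 - ∑ i, g i • p.2 i)) *
          ENNReal.ofReal (∏ i, f i (p.2 i))) =
      ENNReal.ofReal (gaussianDensity 1 (p.1 - ∑ i, g i • p.2 i)) *
          ENNReal.ofReal (∏ i, f i (p.2 i)) := fun p => by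
    rw [lintegral_mul_const _ (by fun_prop), hg1, one_mul]
  simp_rw [h1]
  rw [Measure.volume_eq_prod, lintegral_prod_symm _ (by fun_prop)]
  have h2 : ∀ u : Fin (M + 1) → Fin n → ℝ,
      ∫⁻ y, ENNReal.ofReal (gaussianDensity 1 (y - ∑ i, g i • u i)) *
          ENNReal.ofReal (∏ i, f i (u i)) = ENNReal.ofReal (∏ i, f i (u i)) := fun u => by
    rw [lintegral_mul_const _ (by fun_prop), hg1, one_mul]
  simp_rw [h2]
  have h3 := pi_withDensity (fun i => (hf i).integrable_density) fun i x => ((hf i).pos x).le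
  have hν : (fun i => volume.withDensity fun x => ENNReal.ofReal (f i x)) = ν :=
    funext fun i => ((hf i).eq_withDensity).symm
  have : ∀ i, IsProbabilityMeasure (ν i) := fun i => (hf i).prob
  rw [hν] at h3
  rw [volume_pi, ← setLIntegral_univ, ← withDensity_apply _ MeasurableSet.univ, ← h3, measure_univ]

/-- The density ratio to which Gibbs' inequality is applied. -/
noncomputable def ratio (h g : Fin (M + 1) → ℝ) (f : Fin (M + 1) → (Fin n → ℝ) → ℝ)
    (q : (Fin m × (Fin (M + 1) → Fin n → ℝ)) ×
      (Fin n → ℝ) × (Fin n → ℝ) × (Fin (M + 1) → Fin n → ℝ)) : ℝ :=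
  auxDensity h g f q.2 * (decWeight dec q.2.1 q.1.1 /
    (m * (S.partDensity g q.1.1 q.2.2.1).toReal)) /
    (gaussianDensity 1 (q.2.1 - combine h q.1) * ∏ i, gaussianDensity (v i) (q.2.2.2 i - q.1.2 i))

/-- All the outputs. -/
def output (h g : Fin (M + 1) → ℝ) (ω : Ω) :
    (Fin n → ℝ) × (Fin n → ℝ) × (Fin (M + 1) → Fin n → ℝ) :=
  (S.Y₁ h ω, S.Y₂ g ω, fun i => S.Xt i ω)

variable {dec}

/-- Multiplying by the true noise density turns the ratio into the fictitious joint density, whose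
mass is at most one: `auxDensity` has mass one, and so at most has the guess followed by the
conditional law of the inputs given `(W, Y₂)`. -/
lemma lintegral_ratio_le (hdec : Measurable dec) (hv : ∀ i, v i ≠ 0) (h g : Fin (M + 1) → ℝ)
    {f : Fin (M + 1) → (Fin n → ℝ) → ℝ} {ν : Fin (M + 1) → Measure (Fin n → ℝ)}
    (hf : ∀ i, IsRegularLaw (ν i) (f i)) :
    ∫⁻ ω, ENNReal.ofReal (S.ratio dec h g f (S.input ω, S.output h g ω)) ∂μ ≤ 1 := by
  have hfm := fun i => (hf i).measurable
  have hp := S.measurable_partDensity g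
  have hκ := measurable_decWeight hdec
  have haux : Measurable (auxDensity h g f) := by unfold auxDensity; fun_prop
  have hκ' : Measurable fun q : (Fin m × (Fin (M + 1) → Fin n → ℝ)) ×
      (Fin n → ℝ) × (Fin n → ℝ) × (Fin (M + 1) → Fin n → ℝ) => decWeight dec q.2.1 q.1.1 :=
    hκ.comp (by fun_prop :
      Measurable fun q : (Fin m × (Fin (M + 1) → Fin n → ℝ)) ×
      (Fin n → ℝ) × (Fin n → ℝ) × (Fin (M + 1) → Fin n → ℝ) => (q.2.1, q.1.1))
  have hp' : Measurable fun q : (Fin m × (Fin (M + 1) → Fin n → ℝ)) ×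
      (Fin n → ℝ) × (Fin n → ℝ) × (Fin (M + 1) → Fin n → ℝ) => S.partDensity g q.1.1 q.2.2.1 :=
    hp.comp (by fun_prop :
      Measurable fun q : (Fin m × (Fin (M + 1) → Fin n → ℝ)) ×
      (Fin n → ℝ) × (Fin n → ℝ) × (Fin (M + 1) → Fin n → ℝ) => (q.1.1, q.2.2.1))
  have hr : Measurable (S.ratio dec h g f) := by unfold ratio; fun_prop
  have inv1 : (volume : Measure ((Fin n → ℝ) × (Fin (M + 1) → Fin n → ℝ))).IsAddLeftInvariant :=
    Measure.prod.instIsAddLeftInvariant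
  have inv2 : (volume : Measure ((Fin n → ℝ) × (Fin n → ℝ) ×
      (Fin (M + 1) → Fin n → ℝ))).IsAddLeftInvariant :=
    Measure.prod.instIsAddLeftInvariant
  have h1 := lintegral_add_noise S.measurable_input S.measurable_noise S.indepFun_input_noise
    (measurable_noiseDensity v) (S.map_noise hv)
    (s := fun a => (combine h a, combine g a, a.2)) (by fun_prop) hr.ennreal_ofReal
  -- The kernels of `Y₁` and of the fudge noises cancel. That of `Y₂` is absent from the denominator
  -- of `ratio` and survives as the numerator of the conditional density of the input.
  have h2 : ∀ a z, ENNReal.ofReal (S.ratio dec h g f (a, z)) *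
      noiseDensity v (z - (combine h a, combine g a, a.2)) =
      ENNReal.ofReal (auxDensity h g f z) * (ENNReal.ofReal (decWeight dec z.1 a.1 /
        (m * (S.partDensity g a.1 z.2.1).toReal)) *
        ENNReal.ofReal (gaussianDensity 1 (z.2.1 - combine g a))) := fun a z => by
    have p0 : 0 ≤ auxDensity h g f z :=
      mul_nonneg (gaussianDensity_pos one_ne_zero _).le (mul_nonneg
        (gaussianDensity_pos one_ne_zero _).le (Finset.prod_nonneg fun i _ => ((hf i).pos _).le))
    have p1 := gaussianDensity_pos one_ne_zero (z.1 - combine h a)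
    have p2 := gaussianDensity_pos one_ne_zero (z.2.1 - combine g a)
    have p3 : 0 < ∏ i, gaussianDensity (v i) (z.2.2 i - a.2 i) :=
      Finset.prod_pos fun i _ => gaussianDensity_pos (hv i) _
    have p4 : 0 ≤ decWeight dec z.1 a.1 / (m * (S.partDensity g a.1 z.2.1).toReal) :=
      div_nonneg (decWeight_pos _ _).le (by positivity)
    simp only [ratio, noiseDensity, Prod.fst_sub, Prod.snd_sub, Pi.sub_apply]
    rw [← ENNReal.ofReal_mul p2.le, ← ENNReal.ofReal_mul p1.le, ← ENNReal.ofReal_mul p4,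
      ← ENNReal.ofReal_mul p0, ← ENNReal.ofReal_mul (by positivity)]
    congr 1
    generalize decWeight dec z.1 a.1 / (m * (S.partDensity g a.1 z.2.1).toReal) = k
    field_simp
  -- On each event `W = w` the surviving kernel integrates to `partDensity`, leaving the total
  -- weight of the guess.
  have h3 : ∀ z : (Fin n → ℝ) × (Fin n → ℝ) × (Fin (M + 1) → Fin n → ℝ),
      ∫⁻ a, ENNReal.ofReal (decWeight dec z.1 a.1 /
        (m * (S.partDensity g a.1 z.2.1).toReal)) *
        ENNReal.ofReal (gaussianDensity 1 (z.2.1 - combine g a)) ∂(μ.map S.input) ≤ 1 :=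
      fun z => by
    rw [lintegral_fst_mul (μ.map S.input) (fun w => ENNReal.ofReal (decWeight dec z.1 w /
        (m * (S.partDensity g w z.2.1).toReal))) (by fun_prop)]
    have hm : (0 : ℝ) < m := by exact_mod_cast (dec z.1).pos
    have h4 : ∀ w, ENNReal.ofReal (decWeight dec z.1 w /
        (m * (S.partDensity g w z.2.1).toReal)) * S.partDensity g w z.2.1 =
        ENNReal.ofReal (decWeight dec z.1 w / m) := fun w => by
      have hpos := ENNReal.toReal_pos (S.partDensity_pos g w z.2.1).ne'
        (S.partDensity_lt_top g w z.2.1).ne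
      conv_lhs => rw [← ENNReal.ofReal_toReal (S.partDensity_lt_top g w z.2.1).ne]
      rw [ENNReal.toReal_ofReal hpos.le, ← ENNReal.ofReal_mul
        (div_nonneg (decWeight_pos _ _).le (by positivity))]
      congr 1
      field_simp
    calc _ = ∑ w, ENNReal.ofReal (decWeight dec z.1 w / m) := Finset.sum_congr rfl fun w _ => h4 w
      _ = ENNReal.ofReal (∑ w, decWeight dec z.1 w / m) :=
        (ENNReal.ofReal_sum_of_nonneg fun w _ => div_nonneg (decWeight_pos _ _).le hm.le).symm
      _ ≤ 1 := by
        rw [ENNReal.ofReal_le_one, ← Finset.sum_div, div_le_one hm]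
        exact sum_decWeight_le dec z.1
  have houtput : ∀ ω, S.output h g ω =
      (combine h (S.input ω), combine g (S.input ω), (S.input ω).2) + S.noise ω := fun ω => rfl
  have : IsProbabilityMeasure (μ.map S.input) := Measure.isProbabilityMeasure_map (by fun_prop)
  simp_rw [houtput]
  rw [h1]
  simp_rw [h2]
  rw [lintegral_lintegral_swap (Measurable.aemeasurable (by unfold Function.uncurry; fun_prop)),
    ← lintegral_auxDensity h g hf]
  refine lintegral_mono fun z => ?_
  have hc : Measurable fun a : Fin m × (Fin (M + 1) → Fin n → ℝ) =>
      ENNReal.ofReal (decWeight dec z.1 a.1 / (m * (S.partDensity g a.1 z.2.1).toReal)) *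
        ENNReal.ofReal (gaussianDensity 1 (z.2.1 - combine g a)) := by
    have e1 : Measurable fun a : Fin m × (Fin (M + 1) → Fin n → ℝ) => ENNReal.ofReal
        (decWeight dec z.1 a.1 / (m * (S.partDensity g a.1 z.2.1).toReal)) :=
      (measurable_of_finite fun w => ENNReal.ofReal
        (decWeight dec z.1 w / (m * (S.partDensity g w z.2.1).toReal))).comp measurable_fst
    fun_prop
  rw [lintegral_const_mul _ hc]
  exact mul_le_of_le_one_right' (h3 z)

/-- The constant of the secrecy penalty. -/
noncomputable def penalty (v : Fin (M + 1) → ℝ≥0) (h g : Fin (M + 1) → ℝ) : ℝ :=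
  (Real.log (2 * Real.pi) / 2 + residualBound v h / 2) +
    (Real.log (2 * Real.pi) / 2 + residualBound v g / 2) -
    (Real.log (2 * Real.pi) / 2 + 1 / 2) -
    ∑ i, (Real.log (2 * Real.pi * v i) / 2 + 1 / 2)

/-- The secrecy penalty, with the error probability of an arbitrary decoder. -/
lemma secrecy_penalty (hdec : Measurable dec) (hv : ∀ i, v i ≠ 0)
    (hsq : ∀ i t, Integrable (fun ω => S.X i ω t ^ 2) μ) (h g : Fin (M + 1) → ℝ)
    (hI : mutualInfo μ S.W (S.Y₂ g) ≠ ∞) :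
    (1 - μ.real {ω | dec (S.Y₁ h ω) ≠ S.W ω}) * Real.log m - Real.log 2 ≤
      (∑ i, diffEntropy (μ.map (S.Xt i))) - diffEntropy (μ.map (S.Y₂ g)) +
        (mutualInfo μ S.W (S.Y₂ g)).toReal + n * penalty v h g := by
  choose f hf using S.exists_isRegularLaw_Xt hv hsq
  obtain ⟨p, hp⟩ := S.exists_isRegularLaw_Y₂ hsq g
  obtain ⟨i1, e1⟩ := S.integral_log_decWeight hdec h
  obtain ⟨i2, e2⟩ := S.integral_log_gaussianDensity_residual S.measurable_N₁ S.law_N₁ h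
  obtain ⟨i3, e3⟩ := S.integral_log_gaussianDensity_residual S.measurable_N₂ S.law_N₂ g
  obtain ⟨i4, e4⟩ := integral_log_gaussianDensity_noise S.measurable_N₁ one_ne_zero S.law_N₁
  have h5 := fun i => integral_log_gaussianDensity_noise (S.measurable_Nt i) (hv i) (S.law_Nt i)
  obtain ⟨i6, e6⟩ := S.integral_information_density g hp hI
  have i7 : Integrable (fun ω => Real.log (p (S.Y₂ g ω))) μ :=
    hp.integrable_log.comp_measurable (S.measurable_Y₂ g)
  have e7 : ∫ ω, Real.log (p (S.Y₂ g ω)) ∂μ = -diffEntropy (μ.map (S.Y₂ g)) := by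
    have := hp.measurable
    rw [hp.diffEntropy_eq, neg_neg, integral_map (by fun_prop)
      (Measurable.aestronglyMeasurable (by fun_prop))]
  have i8 : ∀ i, Integrable (fun ω => Real.log (f i (S.Xt i ω))) μ := fun i =>
    (hf i).integrable_log.comp_measurable (S.measurable_Xt i)
  have e8 : ∀ i, ∫ ω, Real.log (f i (S.Xt i ω)) ∂μ = -diffEntropy (μ.map (S.Xt i)) := fun i => by
    have := (hf i).measurable
    rw [(hf i).diffEntropy_eq, neg_neg, integral_map (by fun_prop)
      (Measurable.aestronglyMeasurable (by fun_prop))]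
  have hG := fun x => gaussianDensity_pos (n := n) one_ne_zero x
  have hm : ∀ w : Fin m, (0 : ℝ) < m := fun w => by exact_mod_cast w.pos
  have hc : ∀ ω, 0 < (S.partDensity g (S.W ω) (S.Y₂ g ω)).toReal := fun ω =>
    ENNReal.toReal_pos (S.partDensity_pos g _ _).ne' (S.partDensity_lt_top g _ _).ne
  have hF : ∀ ω, 0 < ∏ i, f i (S.Xt i ω) := fun ω => Finset.prod_pos fun i _ => (hf i).pos _
  have hNt : ∀ ω, 0 < ∏ i, gaussianDensity (v i) (S.Nt i ω) := fun ω =>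
    Finset.prod_pos fun i _ => gaussianDensity_pos (hv i) _
  have hmc : ∀ ω, 0 < m * (S.partDensity g (S.W ω) (S.Y₂ g ω)).toReal := fun ω =>
    mul_pos (hm (S.W ω)) (hc ω)
  have hres : ∀ (a : Fin (M + 1) → ℝ) (N : Ω → Fin n → ℝ) ω,
      (∑ i, a i • S.X i ω) + N ω - ∑ i, a i • S.Xt i ω = S.residual N a ω := fun a N ω => by
    simp only [residual, Xt, smul_add, Finset.sum_add_distrib]
    abel
  have hratio : ∀ ω, S.ratio dec h g f (S.input ω, S.output h g ω) =
      gaussianDensity 1 (S.residual S.N₁ h ω) * (gaussianDensity 1 (S.residual S.N₂ g ω) *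
        ∏ i, f i (S.Xt i ω)) * (decWeight dec (S.Y₁ h ω) (S.W ω) /
        (m * (S.partDensity g (S.W ω) (S.Y₂ g ω)).toReal)) /
        (gaussianDensity 1 (S.N₁ ω) * ∏ i, gaussianDensity (v i) (S.Nt i ω)) := fun ω => by
    rw [← hres h S.N₁ ω, ← hres g S.N₂ ω]
    simp only [ratio, auxDensity, output, input, combine, Y₁, Xt, add_sub_cancel_left]
    rfl
  have hpos : ∀ ω, 0 < S.ratio dec h g f (S.input ω, S.output h g ω) := fun ω => by
    rw [hratio]
    exact div_pos (mul_pos (mul_pos (hG _) (mul_pos (hG _) (hF ω)))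
      (div_pos (decWeight_pos _ _) (hmc ω))) (mul_pos (hG _) (hNt ω))
  -- The density `p (S.Y₂ g ω)` is inserted and removed, so that `log (m * partDensity)` splits into
  -- the information density, of mean `I(W; Y₂)`, and `log p`, of mean `-h(Y₂)`.
  have hlog : ∀ ω, Real.log (S.ratio dec h g f (S.input ω, S.output h g ω)) =
      Real.log (gaussianDensity 1 (S.residual S.N₁ h ω)) +
      Real.log (gaussianDensity 1 (S.residual S.N₂ g ω)) +
      ∑ i, Real.log (f i (S.Xt i ω)) + Real.log (decWeight dec (S.Y₁ h ω) (S.W ω)) -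
      Real.log (m * (S.partDensity g (S.W ω) (S.Y₂ g ω)).toReal / p (S.Y₂ g ω)) -
      Real.log (p (S.Y₂ g ω)) - Real.log (gaussianDensity 1 (S.N₁ ω)) -
      ∑ i, Real.log (gaussianDensity (v i) (S.Nt i ω)) := fun ω => by
    have d1 := decWeight_pos (dec := dec) (S.Y₁ h ω) (S.W ω)
    rw [hratio, Real.log_div (mul_pos (mul_pos (hG _) (mul_pos (hG _) (hF ω)))
        (div_pos d1 (hmc ω))).ne' (mul_pos (hG _) (hNt ω)).ne',
      Real.log_mul (mul_pos (hG _) (mul_pos (hG _) (hF ω))).ne' (div_pos d1 (hmc ω)).ne',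
      Real.log_mul (hG _).ne' (mul_pos (hG _) (hF ω)).ne', Real.log_mul (hG _).ne' (hF ω).ne',
      Real.log_prod fun i _ => ((hf i).pos _).ne', Real.log_div d1.ne' (hmc ω).ne',
      Real.log_mul (hG _).ne' (hNt ω).ne',
      Real.log_prod fun i _ => (gaussianDensity_pos (hv i) _).ne',
      Real.log_div (hmc ω).ne' (hp.pos _).ne']
    ring
  have j8 := integrable_finsetSum Finset.univ fun i _ => i8 i
  have j5 := integrable_finsetSum Finset.univ fun i _ => (h5 i).1
  have a1 := i2.fun_add i3
  have a2 := a1.fun_add j8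
  have a3 := a2.fun_add i1
  have hsub : ∀ {u w : Ω → ℝ}, Integrable u μ → Integrable w μ →
      Integrable (fun ω => u ω - w ω) μ := fun hu hw => hu.sub hw
  have a4 := hsub a3 i6
  have a5 := hsub a4 i7
  have a6 := hsub a5 i4
  have key := integral_log_nonpos (μ := μ) hpos
    ((a6.sub j5).congr (ae_of_all _ fun ω => (hlog ω).symm))
    (S.lintegral_ratio_le hdec hv h g hf)
  rw [integral_congr_ae (ae_of_all _ hlog), integral_sub a6 j5, integral_sub a5 i4,
    integral_sub a4 i7, integral_sub a3 i6, integral_add a2 i1, integral_add a1 j8,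
    integral_add i2 i3, integral_finsetSum _ fun i _ => i8 i,
    integral_finsetSum _ fun i _ => (h5 i).1, e1, e4, e6, e7,
    Finset.sum_congr rfl fun i _ => e8 i, Finset.sum_congr rfl fun i _ => (h5 i).2,
    Finset.sum_neg_distrib, Finset.sum_neg_distrib, ← Finset.mul_sum] at key
  simp only [NNReal.coe_one, mul_one] at key
  unfold penalty
  linarith

end Scheme

end Wiretap

/-! ### Choice of the constants and of `ε`. -/

theorem lemma1 (M : ℕ) (h g : Fin (M + 1) → ℝ) (hh : ∀ i, h i ≠ 0) (hg : ∀ i, g i ≠ 0)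
    (v : Fin (M + 1) → ℝ≥0) (hv0 : ∀ i, 0 < v i)
    (hv : ∀ i, (v i : ℝ) < min (1 / h i ^ 2) (1 / g i ^ 2)) :
    ∃ c c' : ℝ, ∀ P : ℝ, 0 ≤ P → ∃ ε : ℝ, 0 < ε ∧
      ∀ (n m : ℕ), 0 < n →
      ∀ (Ω : Type*) [MeasurableSpace Ω] (μ : Measure Ω) [IsProbabilityMeasure μ]
        (S : Wiretap.Scheme M n m v μ),
      S.PowerConstraint P → S.Reliable h ε → S.Secure g ε →
        (∀ i, Wiretap.HasDiffEntropy (μ.map (S.Xt i))) ∧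
        Wiretap.HasDiffEntropy (μ.map (S.Y₂ g)) ∧
        n * S.rate ≤
          (∑ i, Wiretap.diffEntropy (μ.map (S.Xt i))) - Wiretap.diffEntropy (μ.map (S.Y₂ g))
            + n * c ∧
        ∀ j : Fin (M + 1),
          (∑ i, Wiretap.diffEntropy (μ.map (S.Xt i))) - Wiretap.diffEntropy (μ.map (S.Y₂ g))
            + n * c ≤
          (∑ i ∈ Finset.univ.erase j, Wiretap.diffEntropy (μ.map (S.Xt i))) + n * c' := by
  have hv' : ∀ i, v i ≠ 0 := fun i => (hv0 i).ne'
  -- The slack `3 n` covers `log 2`, the leakage `I(W; Y₂) ≤ n / 2` and the error term `Pe log m ≤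
  -- n`.
  set c := Wiretap.Scheme.penalty v h g + 3 with hc
  -- Summing absolute values gives one constant valid for every `j`.
  set c' := c + ∑ i, |Real.log (|g i|)| with hc'
  refine ⟨c, c', fun P hP => ?_⟩
  -- `n * D` bounds the right-hand side of the second inequality at `j = 0` under the power
  -- constraint; the maximum with one ensures `ε ≤ 1 / 2`.
  set D : ℝ := max 1 ((∑ i ∈ Finset.univ.erase 0, (Real.log (2 * Real.pi) / 2 + (P + v i))) + c')
    with hD
  have hD1 : 1 ≤ D := le_max_left _ _
  have hD0 : 0 < D := by linarith
  refine ⟨1 / (2 * D), by positivity, fun n m hn Ω _ μ _ S hpow hrel hsec => ?_⟩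
  have hn1 : (1 : ℝ) ≤ n := by exact_mod_cast hn
  have hsq := fun i => (hpow i).1
  have hε : 1 / (2 * D) ≤ 1 / 2 := by
    rw [div_le_div_iff_of_pos_left one_pos (by positivity) two_pos]
    linarith
  have hsecond : ∀ j : Fin (M + 1),
      (∑ i, Wiretap.diffEntropy (μ.map (S.Xt i))) - Wiretap.diffEntropy (μ.map (S.Y₂ g))
        + n * c ≤
      (∑ i ∈ Finset.univ.erase j, Wiretap.diffEntropy (μ.map (S.Xt i))) + n * c' := fun j => by
    have h1 := S.diffEntropy_Xt_le_diffEntropy_Y₂ hv' hsq (hg j)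
      ((hv j).trans_le (min_le_right _ _))
    have h2 := Finset.add_sum_erase Finset.univ
      (fun i => Wiretap.diffEntropy (μ.map (S.Xt i))) (Finset.mem_univ j)
    have h3 : -Real.log |g j| ≤ ∑ i, |Real.log (|g i|)| :=
      (neg_le_abs _).trans
        (Finset.single_le_sum (f := fun i => |Real.log (|g i|)|) (fun i _ => abs_nonneg _)
          (Finset.mem_univ j))
    have h4 := mul_le_mul_of_nonneg_left h3 (by linarith : (0 : ℝ) ≤ n)
    rw [hc']
    linarith
  have hlogm : 0 ≤ Real.log m := Real.log_natCast_nonneg m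
  have hfirst : Real.log m ≤
      (∑ i, Wiretap.diffEntropy (μ.map (S.Xt i))) - Wiretap.diffEntropy (μ.map (S.Y₂ g))
        + n * c := by
    obtain ⟨dec, hdec, herr⟩ := hrel
    have hI : Wiretap.mutualInfo μ S.W (S.Y₂ g) ≠ ∞ :=
      ne_top_of_le_ne_top ENNReal.ofReal_ne_top hsec
    have hI' : (Wiretap.mutualInfo μ S.W (S.Y₂ g)).toReal ≤ n * (1 / (2 * D)) :=
      ENNReal.toReal_le_of_le_ofReal (by positivity) hsec
    have h1 := S.secrecy_penalty hdec hv' hsq h g hI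
    have h2 : Real.log m * μ.real {ω | dec (S.Y₁ h ω) ≠ S.W ω} ≤ Real.log m * (1 / (2 * D)) :=
      mul_le_mul_of_nonneg_left herr hlogm
    have h3 : (n : ℝ) * (1 / (2 * D)) ≤ n * (1 / 2) := mul_le_mul_of_nonneg_left hε (by linarith)
    have h4 := hsecond 0
    have h5 : ∑ i ∈ Finset.univ.erase 0, Wiretap.diffEntropy (μ.map (S.Xt i)) ≤
        n * ∑ i ∈ Finset.univ.erase 0, (Real.log (2 * Real.pi) / 2 + (P + v i)) := by
      rw [Finset.mul_sum]
      exact Finset.sum_le_sum fun i _ => S.diffEntropy_Xt_le hv' hn hpow i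
    have h6 := mul_le_mul_of_nonneg_left (le_max_right 1 ((∑ i ∈ Finset.univ.erase 0,
      (Real.log (2 * Real.pi) / 2 + (P + v i))) + c')) (by linarith : (0 : ℝ) ≤ n)
    rw [← hD] at h6
    have h7 : Real.log m * (1 / (2 * D)) ≤ Real.log m * (1 / 2) :=
      mul_le_mul_of_nonneg_left hε hlogm
    have h8 : Real.log 2 ≤ 1 := by linarith [Real.log_two_lt_d9]
    -- Bootstrap: an error probability of at most one half already bounds `log m` by `2 n D`, and
    -- this bound then shrinks the error term from `log m / 2` to `n`.
    have h9 : Real.log m ≤ 2 * (n * D) := by linarith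
    have h10 : Real.log m * (1 / (2 * D)) ≤ n := by
      rw [mul_one_div, div_le_iff₀ (by positivity)]
      linarith
    linarith
  refine ⟨fun i => ?_, ?_, ?_, hsecond⟩
  · obtain ⟨f, hf⟩ := S.exists_isRegularLaw_Xt hv' hsq i
    exact hf.hasDiffEntropy
  · obtain ⟨f, hf⟩ := S.exists_isRegularLaw_Y₂ hsq g
    exact hf.hasDiffEntropy
  · rw [Wiretap.Scheme.rate, ← mul_assoc, mul_one_div_cancel (by positivity), one_mul]
    exact hfirst
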